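/- Let $f_1=f_2=1$, $f_{k+1}=f_k+f_{k-1}$ be the Fibonacci numbers, and let $B_n$ be the braid group on $n$ strands, generated by $\sigma_1,\dots,\sigma_{n-1}$ subject to $\sigma_i\sigma_j=\sigma_j\sigma_i$ for $|i-j|>1$ and $\sigma_{i+1}\sigma_i\sigma_{i+1}=\sigma_i\sigma_{i+1}\sigma_i$. Put $A=e^{-3\pi i/5}$, $\tau=2/(1+\sqrt5)$ and $$a=-A^4,\quad b=A^8,\quad c=A^8\tau^2-A^4\tau,\quad d=A^8\tau^{3/2}+A^4\tau^{3/2},\quad e=A^8\tau-A^4\tau^2 .$$ The Fibonacci representation $\rho_F^{(n)}$ of $B_n$ is the unitary representation on the space with orthonormal basis the strings of $n+1$ symbols from $\{*,p\}$ in which no two symbols $*$ are adjacent, where $\sigma_i$ acts on the $i$-th, $(i+1)$-th and $(i+2)$-th symbols by $$(*pp)\mapsto a(*pp),\quad (*p*)\mapsto b(*p*),\quad (pp*)\mapsto a(pp*),\quad (p{*}p)\mapsto c(p{*}p)+d(ppp),\quad (ppp)\mapsto d(p{*}p)+e(ppp),$$ and leaves all other symbols unchanged. For $x,y\in\{*,p\}$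 let $\rho_{xy}^{(n)}$ be the restriction of $\rho_F^{(n)}$ to the invariant subspace spanned by the strings that begin with $x$ and end with $y$. A group $G$ of unitary matrices of size $N$ is said to be, modulo phase, a dense subgroup of $SU(N)$ if $\{V\in SU(N) : V=zU \text{ for some } U\in G,\ z\in\mathbb{C},\ |z|=1\}$ is dense in $SU(N)$. (i) For every $n\ge 3$, the space of $\rho_{**}^{(n)}$ has dimension $f_{n-1}$, and $\rho_{**}^{(n)}(B_n)$ is, modulo phase, a dense subgroup of $SU(f_{n-1})$. (ii) For every $n\ge 1$, the spaces of $\rho_{*p}^{(n)}$ and $\rho_{p*}^{(n)}$ have dimension $f_n$, and each of $\rho_{*p}^{(n)}(B_n)$ and $\rho_{p*}^{(n)}(B_n)$ is, modulo phase, a dense subgroup of $SU(f_n)$. -/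

import Mathlib

namespace FibBraid

open Matrix

/-! ### The braid group -/

/-- The Artin relations of the braid group on `n` strands, for the generators
`σ_1, …, σ_{n-1}`, which are indexed here by `0, …, n-2`:
`σ_i σ_j = σ_j σ_i` if `|i - j| > 1`, and `σ_{i+1} σ_i σ_{i+1} = σ_i σ_{i+1} σ_i`. -/
inductive ArtinRel (n : ℕ) : FreeGroup (Fin (n - 1)) → Prop
  | comm (i j : Fin (n - 1)) (h : i.val + 1 < j.val) :
      ArtinRel n ((FreeGroup.of i * FreeGroup.of j) * (FreeGroup.of j * FreeGroup.of i)⁻¹)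
  | braid (i j : Fin (n - 1)) (h : i.val + 1 = j.val) :
      ArtinRel n ((FreeGroup.of j * FreeGroup.of i * FreeGroup.of j) *
        (FreeGroup.of i * FreeGroup.of j * FreeGroup.of i)⁻¹)

/-- The braid group `B_n` on `n` strands, by the Artin presentation. -/
abbrev BraidGroup (n : ℕ) : Type := PresentedGroup {r | ArtinRel n r}

/-! ### Strings of symbols -/

/-- The two symbols `*` and `p`. -/
inductive Symbol
  | ast : Symbol
  | p : Symbol
  deriving DecidableEq

instance : Fintype Symbol := ⟨{Symbol.ast, Symbol.p}, fun x => by cases x <;> simp⟩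

open FibBraid.Symbol

/-- Strings of `n + 1` symbols in which no two `*` symbols are adjacent. -/
abbrev SymbolString (n : ℕ) : Type :=
  {s : Fin (n + 1) → Symbol // ∀ i : Fin n, ¬ (s i.castSucc = ast ∧ s i.succ = ast)}

/-- Strings of `n + 1` symbols, no two `*` adjacent, with first symbol `x` and last symbol `y`. -/
abbrev BlockString (n : ℕ) (x y : Symbol) : Type :=
  {s : SymbolString n // s.1 0 = x ∧ s.1 (Fin.last n) = y}

/-- The (0-based) position of the symbol to the left of the crossing `σ_{i+1}`. -/
def posL {n : ℕ} (i : Fin (n - 1)) : Fin (n + 1) := ⟨i.val, by omega⟩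

/-- The (0-based) position of the symbol beneath the crossing `σ_{i+1}`. -/
def posM {n : ℕ} (i : Fin (n - 1)) : Fin (n + 1) := ⟨i.val + 1, by omega⟩

/-- The (0-based) position of the symbol to the right of the crossing `σ_{i+1}`. -/
def posR {n : ℕ} (i : Fin (n - 1)) : Fin (n + 1) := ⟨i.val + 2, by omega⟩

/-! ### The constants -/

/-- `A = e^{-3πi/5}`. -/
noncomputable def cA : ℂ := Complex.exp (-(3 * Real.pi / 5 : ℝ) * Complex.I)

/-- `τ = 2 / (1 + √5)`. -/
noncomputable def tau : ℝ := 2 / (1 + Real.sqrt 5)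

/-- `a = -A⁴`. -/
noncomputable def ca : ℂ := -cA ^ 4

/-- `b = A⁸`. -/
noncomputable def cb : ℂ := cA ^ 8

/-- `c = A⁸ τ² - A⁴ τ`. -/
noncomputable def cc : ℂ := cA ^ 8 * (tau : ℂ) ^ 2 - cA ^ 4 * (tau : ℂ)

/-- `d = A⁸ τ^{3/2} + A⁴ τ^{3/2}`. -/
noncomputable def cd : ℂ :=
  cA ^ 8 * ((tau ^ (3 / 2 : ℝ) : ℝ) : ℂ) + cA ^ 4 * ((tau ^ (3 / 2 : ℝ) : ℝ) : ℂ)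

/-- `e = A⁸ τ - A⁴ τ²`. -/
noncomputable def ce : ℂ := cA ^ 8 * (tau : ℂ) - cA ^ 4 * (tau : ℂ) ^ 2

/-- The local rules of the representation, for arbitrary values of the five constants:
`localRule a b c d e l m r m'` is the coefficient of the string `l m' r` in the image of the
string `l m r` under a crossing above the middle symbol:
`(*pp) ↦ a (*pp)`, `(*p*) ↦ b (*p*)`, `(p*p) ↦ c (p*p) + d (ppp)`, `(pp*) ↦ a (pp*)`,
`(ppp) ↦ d (p*p) + e (ppp)`. -/
def localRule (a b c d e : ℂ) : Symbol → Symbol → Symbol → Symbol → ℂ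
  | ast, p, p, p => a
  | ast, p, ast, p => b
  | p, ast, p, ast => c
  | p, ast, p, p => d
  | p, p, ast, p => a
  | p, p, p, ast => d
  | p, p, p, p => e
  | _, _, _, _ => 0

/-- The matrix, on strings, that applies a local rule at a crossing. The column `s` holds the image
of the string `s`; only strings that agree with `s` off the symbol beneath the crossing occur. -/
def localMatrix (a b c d e : ℂ) {n : ℕ} (i : Fin (n - 1)) :
    Matrix (SymbolString n) (SymbolString n) ℂ :=
  fun t s => if ∀ j, j ≠ posM i → t.1 j = s.1 j then
    localRule a b c d e (s.1 (posL i)) (s.1 (posM i)) (s.1 (posR i)) (t.1 (posM i)) else 0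

/-- The matrix of the elementary crossing `σ_{i+1}` in the Fibonacci representation. -/
noncomputable def crossingMatrix {n : ℕ} (i : Fin (n - 1)) :
    Matrix (SymbolString n) (SymbolString n) ℂ :=
  localMatrix ca cb cc cd ce i

/-! ### The crossing matrices are unitary and satisfy the Artin relations -/

def other : Symbol → Symbol
  | ast => p
  | p => ast

theorem other_other (m : Symbol) : other (other m) = m := by cases m <;> rfl

theorem eq_or_other (m k : Symbol) : k = m ∨ k = other m := by cases m <;> cases k <;> simp [other]

theorem valid_of_succ {n : ℕ} (s : SymbolString n) (j k : Fin (n + 1)) (h : j.val + 1 = k.val) :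
    ¬ (s.1 j = ast ∧ s.1 k = ast) := by
  have := s.2 ⟨j.val, by omega⟩
  have e1 : (⟨j.val, by omega⟩ : Fin n).castSucc = j := by ext; simp
  have e2 : (⟨j.val, by omega⟩ : Fin n).succ = k := by ext; simpa using h
  rwa [e1, e2] at this

theorem p_of_starL {n : ℕ} (s : SymbolString n) (i : Fin (n - 1)) (h : s.1 (posL i) = ast) :
    s.1 (posM i) = p := by
  have := valid_of_succ s (posL i) (posM i) (by simp [posL, posM])
  cases h' : s.1 (posM i) <;> simp_all

theorem p_of_starR {n : ℕ} (s : SymbolString n) (i : Fin (n - 1)) (h : s.1 (posR i) = ast) :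
    s.1 (posM i) = p := by
  have := valid_of_succ s (posM i) (posR i) (by simp [posR, posM])
  cases h' : s.1 (posM i) <;> simp_all

/-- Change the symbol beneath the crossing. -/
def pflip {n : ℕ} (i : Fin (n - 1)) (s : SymbolString n)
    (h : s.1 (posL i) = p ∧ s.1 (posR i) = p) : SymbolString n :=
  ⟨Function.update s.1 (posM i) (other (s.1 (posM i))), by
    intro j
    by_cases h1 : j.castSucc = posM i
    · have : j.succ = posR i := by
        have := congrArg Fin.val h1
        ext; simp [posM, posR] at *; omega
      have h2 : j.succ ≠ posM i := by rw [this]; simp [posR, posM]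
      rw [Function.update_of_ne h2, this, h.2]; simp
    · by_cases h2 : j.succ = posM i
      · have : j.castSucc = posL i := by
          have := congrArg Fin.val h2
          ext; simp [posM, posL] at *; omega
        rw [Function.update_of_ne h1, this, h.1]; simp
      · rw [Function.update_of_ne h1, Function.update_of_ne h2]; exact s.2 j⟩

/-- Change the symbol beneath the crossing if the result is an allowed string. -/
def tflip {n : ℕ} (i : Fin (n - 1)) (s : SymbolString n) : SymbolString n :=
  if h : s.1 (posL i) = p ∧ s.1 (posR i) = p then pflip i s h else s

theorem tflip_of_ne {n : ℕ} (i : Fin (n - 1)) (s : SymbolString n) (j : Fin (n + 1))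
    (hj : j ≠ posM i) : (tflip i s).1 j = s.1 j := by
  unfold tflip
  split_ifs with h
  · simp [pflip, Function.update_of_ne hj]
  · rfl

theorem tflip_M {n : ℕ} (i : Fin (n - 1)) (s : SymbolString n)
    (h1 : s.1 (posL i) = p) (h2 : s.1 (posR i) = p) :
    (tflip i s).1 (posM i) = other (s.1 (posM i)) := by
  simp [tflip, h1, h2, pflip]

theorem posL_ne {n : ℕ} (i : Fin (n - 1)) : posL i ≠ posM i := by simp [posL, posM]
theorem posR_ne {n : ℕ} (i : Fin (n - 1)) : posR i ≠ posM i := by simp [posR, posM]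

theorem tflip_tflip {n : ℕ} (i : Fin (n - 1)) (s : SymbolString n) :
    tflip i (tflip i s) = s := by
  by_cases h : s.1 (posL i) = p ∧ s.1 (posR i) = p
  · apply Subtype.ext; funext j
    by_cases hj : j = posM i
    · subst hj
      rw [tflip_M, tflip_M _ _ h.1 h.2, other_other]
      · rw [tflip_of_ne _ _ _ (posL_ne i)]; exact h.1
      · rw [tflip_of_ne _ _ _ (posR_ne i)]; exact h.2
    · rw [tflip_of_ne _ _ _ hj, tflip_of_ne _ _ _ hj]
  · simp [tflip, h]

theorem tflip_comm {n : ℕ} (i k : Fin (n - 1)) (h : i.val + 1 < k.val) (s : SymbolString n) :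
    tflip i (tflip k s) = tflip k (tflip i s) := by
  have a1 : posL i ≠ posM k := by simp [posL, posM]; omega
  have a2 : posR i ≠ posM k := by simp [posR, posM]; omega
  have a3 : posM i ≠ posM k := by simp [posM]; omega
  have a4 : posL k ≠ posM i := by simp [posL, posM]; omega
  have a5 : posR k ≠ posM i := by simp [posR, posM]; omega
  by_cases hi : s.1 (posL i) = p ∧ s.1 (posR i) = p
  · by_cases hk : s.1 (posL k) = p ∧ s.1 (posR k) = p
    · apply Subtype.ext; funext j
      by_cases h1 : j = posM i
      · subst h1
        rw [tflip_M, tflip_of_ne k _ _ a3, tflip_of_ne k _ _ a3, tflip_M _ _ hi.1 hi.2]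
        · rw [tflip_of_ne _ _ _ a1]; exact hi.1
        · rw [tflip_of_ne _ _ _ a2]; exact hi.2
      · by_cases h2 : j = posM k
        · subst h2
          rw [tflip_of_ne i _ _ h1, tflip_M k s hk.1 hk.2, tflip_M, tflip_of_ne i _ _ h1]
          · rw [tflip_of_ne _ _ _ a4]; exact hk.1
          · rw [tflip_of_ne _ _ _ a5]; exact hk.2
        · rw [tflip_of_ne _ _ _ h1, tflip_of_ne _ _ _ h2, tflip_of_ne _ _ _ h2,
            tflip_of_ne _ _ _ h1]
    · have e1 : tflip k s = s := by simp only [tflip, dif_neg hk]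
      have e2 : tflip k (tflip i s) = tflip i s := by
        rw [tflip, dif_neg]; rwa [tflip_of_ne _ _ _ a4, tflip_of_ne _ _ _ a5]
      rw [e1, e2]
  · have e1 : tflip i s = s := by simp only [tflip, dif_neg hi]
    have e2 : tflip i (tflip k s) = tflip k s := by
      rw [tflip, dif_neg]; rwa [tflip_of_ne _ _ _ a1, tflip_of_ne _ _ _ a2]
    rw [e1, e2]

theorem eq_or_tflip {n : ℕ} (i : Fin (n - 1)) (t u : SymbolString n)
    (h : ∀ j, j ≠ posM i → t.1 j = u.1 j) : u = t ∨ u = tflip i t := by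
  rcases eq_or_other (t.1 (posM i)) (u.1 (posM i)) with h1 | h1
  · left; apply Subtype.ext; funext j
    by_cases hj : j = posM i
    · rw [hj, h1]
    · exact (h j hj).symm
  · by_cases hp : t.1 (posL i) = p ∧ t.1 (posR i) = p
    · right; apply Subtype.ext; funext j
      by_cases hj : j = posM i
      · rw [hj, h1, tflip_M _ _ hp.1 hp.2]
      · rw [tflip_of_ne _ _ _ hj]; exact (h j hj).symm
    · exfalso
      have : t.1 (posM i) = p ∧ u.1 (posM i) = p := by
        rcases not_and_or.mp hp with h' | h'
        · have hs : t.1 (posL i) = ast := by cases h'' : t.1 (posL i) <;> simp_all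
          exact ⟨p_of_starL _ _ hs, p_of_starL _ _ (by rw [← h _ (posL_ne i)]; exact hs)⟩
        · have hs : t.1 (posR i) = ast := by cases h'' : t.1 (posR i) <;> simp_all
          exact ⟨p_of_starR _ _ hs, p_of_starR _ _ (by rw [← h _ (posR_ne i)]; exact hs)⟩
      rw [this.1, this.2] at h1
      simp [other] at h1

def dg (a b c e : ℂ) : Symbol → Symbol → Symbol → ℂ
  | ast, _, ast => b
  | p, ast, p => c
  | p, p, p => e
  | _, _, _ => a

def od (d : ℂ) : Symbol → Symbol → ℂ
  | p, p => d
  | _, _ => 0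

theorem localMatrix_mul_apply (a b c d e : ℂ) {n : ℕ} (i : Fin (n - 1))
    (N : Matrix (SymbolString n) (SymbolString n) ℂ) (t s : SymbolString n) :
    (localMatrix a b c d e i * N) t s =
      dg a b c e (t.1 (posL i)) (t.1 (posM i)) (t.1 (posR i)) * N t s +
      od d (t.1 (posL i)) (t.1 (posR i)) * N (tflip i t) s := by
  have hdiag : localMatrix a b c d e i t t =
      dg a b c e (t.1 (posL i)) (t.1 (posM i)) (t.1 (posR i)) := by
    have h1 := p_of_starL t i
    have h2 := p_of_starR t i
    simp only [localMatrix, implies_true, if_true]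
    cases hL : t.1 (posL i) <;> cases hM : t.1 (posM i) <;> cases hR : t.1 (posR i) <;>
      simp only [hL, hM, hR, reduceCtorEq, imp_false, true_imp_iff, not_true_eq_false] at h1 h2 <;>
      rfl
  rw [Matrix.mul_apply]
  by_cases hp : t.1 (posL i) = p ∧ t.1 (posR i) = p
  · have hne : t ≠ tflip i t := by
      intro h
      have := congrArg (fun x : SymbolString n => x.1 (posM i)) h
      simp only [tflip_M i t hp.1 hp.2] at this
      revert this
      cases t.1 (posM i) <;> simp [other]
    have hoff : localMatrix a b c d e i t (tflip i t) = d := by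
      have : ∀ j, j ≠ posM i → t.1 j = (tflip i t).1 j := fun j hj => (tflip_of_ne i t j hj).symm
      simp only [localMatrix]
      rw [if_pos this, tflip_of_ne _ _ _ (posL_ne i), tflip_of_ne _ _ _ (posR_ne i),
        tflip_M i t hp.1 hp.2, hp.1, hp.2]
      cases hM : t.1 (posM i) <;> simp [localRule, other]
    rw [← Finset.sum_subset (Finset.subset_univ {t, tflip i t}), Finset.sum_pair hne, hdiag, hoff,
      hp.1, hp.2]
    · rfl
    · intro u _ hu
      have : ¬ ∀ j, j ≠ posM i → t.1 j = u.1 j := by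
        intro h
        rcases eq_or_tflip i t u h with h | h <;> simp [h] at hu
      simp [localMatrix, this]
  · have ho : od d (t.1 (posL i)) (t.1 (posR i)) = 0 := by
      cases hL : t.1 (posL i) <;> cases hR : t.1 (posR i) <;> simp_all [od]
    rw [ho, zero_mul, add_zero, Finset.sum_eq_single t, hdiag]
    · intro u _ hu
      have : ¬ ∀ j, j ≠ posM i → t.1 j = u.1 j := by
        intro h
        rcases eq_or_tflip i t u h with h | h
        · exact hu h
        · apply hu; rw [h]; simp only [tflip, dif_neg hp]
      simp [localMatrix, this]
    · simp

theorem localMatrix_comm (a b c d e : ℂ) {n : ℕ} (i k : Fin (n - 1)) (h : i.val + 1 < k.val) :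
    localMatrix a b c d e i * localMatrix a b c d e k =
      localMatrix a b c d e k * localMatrix a b c d e i := by
  have a1 : posL i ≠ posM k := by simp [posL, posM]; omega
  have a2 : posR i ≠ posM k := by simp [posR, posM]; omega
  have a3 : posM i ≠ posM k := by simp [posM]; omega
  have a4 : posL k ≠ posM i := by simp [posL, posM]; omega
  have a5 : posR k ≠ posM i := by simp [posR, posM]; omega
  suffices H : ∀ N : Matrix (SymbolString n) (SymbolString n) ℂ,
      localMatrix a b c d e i * (localMatrix a b c d e k * N) =
        localMatrix a b c d e k * (localMatrix a b c d e i * N) by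
    simpa using H 1
  intro N
  ext t s
  simp only [localMatrix_mul_apply, tflip_of_ne _ _ _ a1, tflip_of_ne _ _ _ a2,
    tflip_of_ne _ _ _ a3, tflip_of_ne _ _ _ a4, tflip_of_ne _ _ _ a5,
    tflip_of_ne _ _ _ a3.symm, tflip_comm i k h]
  ring

theorem localMatrix_mul_eq_one (a b c d e a' b' c' d' e' : ℂ) {n : ℕ} (i : Fin (n - 1))
    (ha : a * a' = 1) (hb : b * b' = 1) (h1 : c * c' + d * d' = 1) (h2 : c * d' + d * e' = 0)
    (h3 : d * c' + e * d' = 0) (h4 : d * d' + e * e' = 1) :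
    localMatrix a b c d e i * localMatrix a' b' c' d' e' i = 1 := by
  suffices H : ∀ N : Matrix (SymbolString n) (SymbolString n) ℂ,
      localMatrix a b c d e i * (localMatrix a' b' c' d' e' i * N) = N by
    simpa using H 1
  intro N
  ext t s
  simp only [localMatrix_mul_apply, tflip_of_ne _ _ _ (posL_ne i), tflip_of_ne _ _ _ (posR_ne i),
    tflip_tflip]
  have hf := tflip_M i t
  generalize N (tflip i t) s = y
  generalize N t s = x
  revert hf
  generalize (tflip i t).1 (posM i) = m'
  cases hL : t.1 (posL i) <;> cases hM : t.1 (posM i) <;> cases hR : t.1 (posR i) <;> intro hf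
  all_goals simp [other] at hf
  all_goals try subst hf
  all_goals simp only [dg, od]
  all_goals first
    | linear_combination x * ha
    | linear_combination x * hb
    | linear_combination x * h1 + y * h2
    | linear_combination x * h4 + y * h3

theorem localMatrix_braid (a b c d e : ℂ) {n : ℕ} (i k : Fin (n - 1)) (h : i.val + 1 = k.val)
    (q1 : b * c ^ 2 + a * d ^ 2 = b ^ 2 * c) (q2 : b * c * d + a * d * e = a * b * d)
    (q3 : a * e ^ 2 + b * d ^ 2 = a ^ 2 * e) (q4 : a ^ 2 * c = a * c ^ 2 + d ^ 2 * e)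
    (q5 : a * d * e = a * c * d + d * e ^ 2) :
    localMatrix a b c d e k * localMatrix a b c d e i * localMatrix a b c d e k =
      localMatrix a b c d e i * localMatrix a b c d e k * localMatrix a b c d e i := by
  have e1 : posM k = posR i := by simp [posR, posM]; omega
  have e2 : posL k = posM i := by simp [posL, posM]; omega
  have a4 : posR k ≠ posM i := by simp [posR, posM]; omega
  have a5 : posL i ≠ posR i := by simp [posR, posL]
  have a6 : posR k ≠ posR i := by simp [posR]; omega
  suffices H : ∀ N : Matrix (SymbolString n) (SymbolString n) ℂ,
      localMatrix a b c d e k * (localMatrix a b c d e i * (localMatrix a b c d e k * N)) =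
        localMatrix a b c d e i * (localMatrix a b c d e k * (localMatrix a b c d e i * N)) by
    simpa [Matrix.mul_assoc] using H 1
  intro N
  ext t s
  have b1 : ∀ u : SymbolString n, (tflip k u).1 (posL i) = u.1 (posL i) :=
    fun u => tflip_of_ne _ _ _ (by rw [e1]; exact a5)
  have b2 : ∀ u : SymbolString n, (tflip k u).1 (posM i) = u.1 (posM i) :=
    fun u => tflip_of_ne _ _ _ (by rw [e1]; exact (posR_ne i).symm)
  have b3 : ∀ u : SymbolString n, (tflip k u).1 (posR k) = u.1 (posR k) :=
    fun u => tflip_of_ne _ _ _ (posR_ne k)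
  have b4 : ∀ u : SymbolString n, (tflip i u).1 (posL i) = u.1 (posL i) :=
    fun u => tflip_of_ne _ _ _ (posL_ne i)
  have b5 : ∀ u : SymbolString n, (tflip i u).1 (posR i) = u.1 (posR i) :=
    fun u => tflip_of_ne _ _ _ (posR_ne i)
  have b6 : ∀ u : SymbolString n, (tflip i u).1 (posR k) = u.1 (posR k) :=
    fun u => tflip_of_ne _ _ _ a4
  have c1 : ∀ u : SymbolString n, u.1 (posL i) = p → u.1 (posR i) = p →
      (tflip i u).1 (posM i) = other (u.1 (posM i)) := tflip_M i
  have c2 : ∀ u : SymbolString n, u.1 (posM i) = p → u.1 (posR k) = p →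
      (tflip k u).1 (posR i) = other (u.1 (posR i)) := by
    intro u; rw [← e1, ← e2]; exact tflip_M k u
  have v1 := p_of_starL t i
  have v2 := p_of_starR t i
  have v3 := p_of_starR t k
  rw [e1] at v3
  simp only [localMatrix_mul_apply, e1, e2, b1, b2, b3, b4, b5, b6, tflip_tflip]
  cases hL : t.1 (posL i) <;> cases hM : t.1 (posM i) <;> cases hR : t.1 (posR i) <;>
    cases hQ : t.1 (posR k) <;> simp only [hL, hM, hR, hQ, reduceCtorEq, imp_false, true_imp_iff,
      not_true_eq_false] at v1 v2 v3
  all_goals simp [hL, hM, hR, hQ, c1, c2, b1, b2, b5, b6, dg, od, other]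
  · linear_combination N t s * q1 + N (tflip k t) s * q2
  · linear_combination N t s * q3 + N (tflip k t) s * q2
  · linear_combination -N t s * q1 - N (tflip i t) s * q2
  · linear_combination N t s * q4 + N (tflip i t) s * q5
  · linear_combination -N t s * q4 - N (tflip k t) s * q5
  · linear_combination -N t s * q3 - N (tflip i t) s * q2
  · linear_combination (N (tflip i t) s - N (tflip k t) s) * q5

theorem localMatrix_conjTranspose (a b c d e : ℂ) {n : ℕ} (i : Fin (n - 1)) :
    star (localMatrix a b c d e i) =
      localMatrix (star a) (star b) (star c) (star d) (star e) i := by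
  ext t s
  rw [Matrix.star_apply]
  by_cases h : ∀ j, j ≠ posM i → t.1 j = s.1 j
  · have h' : ∀ j, j ≠ posM i → s.1 j = t.1 j := fun j hj => (h j hj).symm
    simp only [localMatrix]
    rw [if_pos h, if_pos h', h _ (posL_ne i), h _ (posR_ne i)]
    cases s.1 (posL i) <;> cases s.1 (posM i) <;> cases s.1 (posR i) <;> cases t.1 (posM i) <;>
      simp [localRule]
  · have h' : ¬ ∀ j, j ≠ posM i → s.1 j = t.1 j := fun h' => h fun j hj => (h' j hj).symm
    simp [localMatrix, h, h']

theorem tau_eq : tau = (Real.sqrt 5 - 1) / 2 := by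
  have h5 : Real.sqrt 5 ^ 2 = 5 := Real.sq_sqrt (by norm_num)
  have : (1 + Real.sqrt 5) ≠ 0 := by positivity
  rw [tau, div_eq_iff this]; linarith [h5]

theorem tau_pos : 0 < tau := by unfold tau; positivity

theorem tau_sq : tau ^ 2 + tau = 1 := by
  have h5 : Real.sqrt 5 ^ 2 = 5 := Real.sq_sqrt (by norm_num)
  rw [tau_eq]; linarith [h5]

theorem tau_rpow_sq : (tau ^ (3 / 2 : ℝ)) ^ 2 = tau ^ 3 := by
  rw [← Real.rpow_natCast (tau ^ (3 / 2 : ℝ)), ← Real.rpow_mul tau_pos.le, ← Real.rpow_natCast]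
  norm_num

theorem ca_eq : ca = -Complex.exp ((-(2 * Real.pi / 5) : ℝ) * Complex.I) := by
  have h2 : Complex.exp (-(2 * Real.pi * Complex.I)) = 1 := by
    rw [Complex.exp_neg, Complex.exp_two_pi_mul_I, inv_one]
  rw [ca, cA, ← Complex.exp_nat_mul]
  congr 1
  rw [← mul_one (Complex.exp ((-(2 * Real.pi / 5) : ℝ) * Complex.I)), ← h2, ← Complex.exp_add]
  congr 1
  push_cast
  ring

theorem ca_mul_star : ca * star ca = 1 := by
  rw [ca_eq, star_neg, neg_mul_neg, Complex.star_def, Complex.mul_conj, Complex.normSq_eq_norm_sq,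
    Complex.norm_exp_ofReal_mul_I]
  simp

theorem ca_add_star : ca + star ca = -(tau : ℂ) := by
  have h5 : Real.sqrt 5 ^ 2 = 5 := Real.sq_sqrt (by norm_num)
  have hc : Real.cos (2 * Real.pi / 5) = (Real.sqrt 5 - 1) / 4 := by
    have : 2 * Real.pi / 5 = 2 * (Real.pi / 5) := by ring
    rw [this, Real.cos_two_mul, Real.cos_pi_div_five]
    linarith [h5]
  rw [Complex.star_def, Complex.add_conj, ca_eq, Complex.neg_re, Complex.exp_ofReal_mul_I_re,
    Real.cos_neg, hc, tau_eq]
  push_cast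
  ring

theorem ca_sq : ca ^ 2 + tau * ca + 1 = 0 := by
  linear_combination (-ca) * ca_add_star.symm + ca_mul_star.symm

theorem cb_eq : cb = ca ^ 2 := by simp only [cb, ca]; ring
theorem cc_eq : cc = ca ^ 2 * (tau : ℂ) ^ 2 + ca * tau := by simp only [cc, ca]; ring
theorem cd_eq : cd = (ca ^ 2 - ca) * ((tau ^ (3 / 2 : ℝ) : ℝ) : ℂ) := by simp only [cd, ca]; ring
theorem ce_eq : ce = ca ^ 2 * (tau : ℂ) + ca * (tau : ℂ) ^ 2 := by simp only [ce, ca]; ring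

theorem crossingMatrix_mem {n : ℕ} (i : Fin (n - 1)) :
    crossingMatrix i ∈ unitaryGroup (SymbolString n) ℂ := by
  rw [mem_unitaryGroup_iff, crossingMatrix, localMatrix_conjTranspose]
  have h0 := ca_mul_star
  have h2 : (tau : ℂ) ^ 2 + tau = 1 := by exact_mod_cast tau_sq
  have h3 : ((tau ^ (3 / 2 : ℝ) : ℝ) : ℂ) ^ 2 = (tau : ℂ) ^ 3 := by exact_mod_cast tau_rpow_sq
  have hb := cb_eq
  have hc := cc_eq
  have hd := cd_eq
  have he := ce_eq
  have hb' : star cb = star ca ^ 2 := by rw [hb]; simp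
  have hc' : star cc = star ca ^ 2 * (tau : ℂ) ^ 2 + star ca * tau := by rw [hc]; simp
  have hd' : star cd = (star ca ^ 2 - star ca) * ((tau ^ (3 / 2 : ℝ) : ℝ) : ℂ) := by
    rw [hd]
    simp only [star_mul', star_sub, star_pow, Complex.star_def, Complex.conj_ofReal]
  have he' : star ce = star ca ^ 2 * (tau : ℂ) + star ca * (tau : ℂ) ^ 2 := by rw [he]; simp
  generalize ((tau ^ (3 / 2 : ℝ) : ℝ) : ℂ) = w at *
  generalize (tau : ℂ) = t at *
  generalize star ca = a' at *
  generalize star cb = b' at *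
  generalize star cc = c' at *
  generalize star cd = d' at *
  generalize star ce = e' at *
  apply localMatrix_mul_eq_one <;> clear i <;> grind

theorem crossingMatrix_comm {n : ℕ} (i k : Fin (n - 1)) (h : i.val + 1 < k.val) :
    crossingMatrix i * crossingMatrix k = crossingMatrix k * crossingMatrix i :=
  localMatrix_comm _ _ _ _ _ i k h

theorem crossingMatrix_braid {n : ℕ} (i k : Fin (n - 1)) (h : i.val + 1 = k.val) :
    crossingMatrix k * crossingMatrix i * crossingMatrix k =
      crossingMatrix i * crossingMatrix k * crossingMatrix i := by
  have h1 := ca_sq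
  have h2 : (tau : ℂ) ^ 2 + tau = 1 := by exact_mod_cast tau_sq
  have h3 : ((tau ^ (3 / 2 : ℝ) : ℝ) : ℂ) ^ 2 = (tau : ℂ) ^ 3 := by exact_mod_cast tau_rpow_sq
  have hb := cb_eq
  have hc := cc_eq
  have hd := cd_eq
  have he := ce_eq
  generalize ((tau ^ (3 / 2 : ℝ) : ℝ) : ℂ) = w at *
  generalize (tau : ℂ) = t at *
  apply localMatrix_braid _ _ _ _ _ i k h <;> clear h i k <;> grind

/-! ### The Fibonacci representation and its blocks -/

/-- The elementary crossing as a unitary matrix. -/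
noncomputable def crossing {n : ℕ} (i : Fin (n - 1)) : unitaryGroup (SymbolString n) ℂ :=
  ⟨crossingMatrix i, crossingMatrix_mem i⟩

theorem lift_crossing_eq_one {n : ℕ} (r : FreeGroup (Fin (n - 1))) (hr : ArtinRel n r) :
    FreeGroup.lift (crossing (n := n)) r = 1 := by
  cases hr with
  | comm i j h =>
    rw [map_mul, map_inv, mul_inv_eq_one]
    simp only [map_mul, FreeGroup.lift_apply_of]
    exact Subtype.ext (crossingMatrix_comm i j h)
  | braid i j h =>
    rw [map_mul, map_inv, mul_inv_eq_one]
    simp only [map_mul, FreeGroup.lift_apply_of]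
    exact Subtype.ext (crossingMatrix_braid i j h)

/-- The Fibonacci representation `ρ_F^{(n)}` of `B_n` on the space of formal linear combinations
of the strings of `n + 1` symbols with no two `*` adjacent: it sends each elementary crossing to
its crossing matrix. -/
noncomputable def fibRep (n : ℕ) : BraidGroup n →* unitaryGroup (SymbolString n) ℂ :=
  PresentedGroup.toGroup (f := crossing) lift_crossing_eq_one

/-- A matrix that never changes the first or the last symbol of a string. -/
def FixesEnds {n : ℕ} (M : Matrix (SymbolString n) (SymbolString n) ℂ) : Prop :=
  ∀ t s : SymbolString n,
    ¬ (t.1 0 = s.1 0 ∧ t.1 (Fin.last n) = s.1 (Fin.last n)) → M t s = 0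

theorem FixesEnds.mul {n : ℕ} {M N : Matrix (SymbolString n) (SymbolString n) ℂ}
    (hM : FixesEnds M) (hN : FixesEnds N) : FixesEnds (M * N) := by
  intro t s h
  rw [Matrix.mul_apply]
  refine Finset.sum_eq_zero fun u _ => ?_
  by_cases h1 : t.1 0 = u.1 0 ∧ t.1 (Fin.last n) = u.1 (Fin.last n)
  · rw [hN u s (by rw [← h1.1, ← h1.2]; exact h), mul_zero]
  · rw [hM t u h1, zero_mul]

theorem FixesEnds.star {n : ℕ} {M : Matrix (SymbolString n) (SymbolString n) ℂ}
    (hM : FixesEnds M) : FixesEnds (star M) := by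
  intro t s h
  rw [Matrix.star_apply, hM s t (by rwa [eq_comm, eq_comm (a := s.1 (Fin.last n))]), star_zero]

theorem FixesEnds.crossingMatrix {n : ℕ} (i : Fin (n - 1)) :
    FixesEnds (crossingMatrix (n := n) i) := by
  intro t s h
  rw [FibBraid.crossingMatrix, localMatrix, if_neg]
  intro h'
  exact h ⟨h' _ (by simp [posM, Fin.ext_iff]), h' _ (by simp [posM, Fin.ext_iff]; omega)⟩

theorem fibRep_fixesEnds {n : ℕ} (g : BraidGroup n) : FixesEnds (fibRep n g).1 := by
  let H : Subgroup (unitaryGroup (SymbolString n) ℂ) :=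
    { carrier := {U | FixesEnds U.1}
      mul_mem' := fun h1 h2 => FixesEnds.mul h1 h2
      one_mem' := by
        intro t s h
        have : t ≠ s := by rintro rfl; exact h ⟨rfl, rfl⟩
        simp [this]
      inv_mem' := fun h => FixesEnds.star h }
  have : ∀ x : BraidGroup n, x ∈ H.comap (fibRep n) := by
    intro x
    refine PresentedGroup.generated_by _ _ (fun i => ?_) x
    show FixesEnds (fibRep n (PresentedGroup.of i)).1
    rw [fibRep, PresentedGroup.toGroup.of]
    exact FixesEnds.crossingMatrix i
  exact this g

/-- Restriction of a matrix to the strings with first symbol `x` and last symbol `y`. -/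
def blockMatrix {n : ℕ} (x y : Symbol) (M : Matrix (SymbolString n) (SymbolString n) ℂ) :
    Matrix (BlockString n x y) (BlockString n x y) ℂ :=
  M.submatrix Subtype.val Subtype.val

theorem blockMatrix_mul {n : ℕ} (x y : Symbol) (M N : Matrix (SymbolString n) (SymbolString n) ℂ)
    (hM : FixesEnds M) : blockMatrix x y (M * N) = blockMatrix x y M * blockMatrix x y N := by
  ext t s
  simp only [blockMatrix, Matrix.submatrix_apply, Matrix.mul_apply]
  rw [← Fintype.sum_subtype_add_sum_subtype (fun u : SymbolString n =>
    u.1 0 = x ∧ u.1 (Fin.last n) = y), add_eq_left]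
  refine Finset.sum_eq_zero fun u _ => ?_
  rw [hM t.1 u.1 (by rw [t.2.1, t.2.2]; exact fun h => u.2 ⟨h.1.symm, h.2.symm⟩), zero_mul]

theorem blockMatrix_one {n : ℕ} (x y : Symbol) :
    blockMatrix (n := n) x y 1 = 1 :=
  Matrix.submatrix_one _ Subtype.val_injective

theorem blockMatrix_star {n : ℕ} (x y : Symbol) (M : Matrix (SymbolString n) (SymbolString n) ℂ) :
    blockMatrix x y (star M) = star (blockMatrix x y M) := rfl

/-- The representation of `B_n` defined by the action of the Fibonacci representation on the
invariant subspace spanned by the strings with first symbol `x` and last symbol `y`. -/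
noncomputable def blockRep (n : ℕ) (x y : Symbol) :
    BraidGroup n →* unitaryGroup (BlockString n x y) ℂ where
  toFun g := ⟨blockMatrix x y (fibRep n g).1, by
    rw [mem_unitaryGroup_iff, ← blockMatrix_star, ← blockMatrix_mul _ _ _ _ (fibRep_fixesEnds g),
      mem_unitaryGroup_iff.mp (fibRep n g).2, blockMatrix_one]⟩
  map_one' := Subtype.ext (by
    show blockMatrix x y (fibRep n 1).1 = 1
    rw [map_one]; exact blockMatrix_one x y)
  map_mul' g h := Subtype.ext (by
    show blockMatrix x y (fibRep n (g * h)).1 = _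
    rw [map_mul]; exact blockMatrix_mul x y _ _ (fibRep_fixesEnds g))

/-! ### Density modulo phase -/

/-- For a group `G` of unitary matrices, the subgroup of the special unitary group formed by the
matrices that coincide with an element of `G` up to a phase. -/
def moduloPhase {ι : Type} [Fintype ι] [DecidableEq ι] (G : Subgroup (unitaryGroup ι ℂ)) :
    Subgroup (specialUnitaryGroup ι ℂ) where
  carrier := {V | ∃ z : ℂ, ‖z‖ = 1 ∧ ∃ U ∈ G, (V : Matrix ι ι ℂ) = z • (U : Matrix ι ι ℂ)}
  mul_mem' := by
    rintro V V' ⟨z, hz, U, hU, h⟩ ⟨z', hz', U', hU', h'⟩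
    refine ⟨z * z', by simp [hz, hz'], U * U', G.mul_mem hU hU', ?_⟩
    show (V : Matrix ι ι ℂ) * (V' : Matrix ι ι ℂ) = (z * z') • ((U : Matrix ι ι ℂ) * U'.1)
    rw [h, h', smul_mul_smul_comm]
  one_mem' := ⟨1, by simp, 1, G.one_mem, by simp⟩
  inv_mem' := by
    rintro V ⟨z, hz, U, hU, h⟩
    refine ⟨star z, by simp [hz], U⁻¹, G.inv_mem hU, ?_⟩
    show star (V : Matrix ι ι ℂ) = star z • star (U : Matrix ι ι ℂ)
    rw [h, star_smul]

/-- The image of a unitary representation, taken modulo phase, is a dense subgroup of the special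
unitary group. -/
def DenseModuloPhase {H : Type} [Group H] {ι : Type} [Fintype ι] [DecidableEq ι]
    (ρ : H →* unitaryGroup ι ℂ) : Prop :=
  Dense (moduloPhase ρ.range : Set (specialUnitaryGroup ι ℂ))

end FibBraid

namespace FibBraid

open Matrix Filter Topology

/-! ### One-parameter subgroups as limits of powers -/

/-! Everything reduces to the block `*p`. A final `*` is forced to follow a `p`, so the block `**`
on n+1 strands is the block `*p` on n strands, and the crossings of the latter act in the same way
(`crossingMatrix_append`). Reversing strings turns `p*` into `*p` (`crossingMatrix_rev`).

Density criterion (`mem_of_adIrreducible`). Let C be the closure in SU(N) of the image modulo phase.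
The generators of the one-parameter subgroups of C form a real space of skew-Hermitian matrices,
stable under conjugation by the crossings. It is nonzero as soon as C has an element of infinite
order, and it contains no nonzero scalar because determinants are 1. If conjugation by the crossings
is irreducible on traceless matrices, the complex span contains sl_N. Hence the real space contains
su_N, whose exponentials together with the scalars of SU(N) give all of SU(N).

Irreducibility is proved by induction on the number of strands (`AdIrreducible.sum`). Sorting the
strings that end in `p` by their next-to-last symbol splits the space as f_{n+1} = f_n + f_{n-1}.
The earlier crossings are block diagonal and act on the large block as on n strands; a product of
crossings is the diagonal matrix (a², 1), which separates the four blocks; the last crossing mixes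
them. Since f_n > f_{n-1}, a dimension count shows that a stable subspace contains traceless
matrices supported on the large block alone, and the last crossing spreads them everywhere.

Infinite order (`hasInfiniteOrder_of_mulVec`). On the plane of `*pp…p` and `*p*p…p`, the matrix M =
σ₁σ₂⁻¹ satisfies M² = τ²M - 1. The Galois conjugate τ ↦ -1-τ turns the trace τ² into 2+τ > 2, so the
conjugate recursion grows and no power of M is scalar. -/

theorem norm_pow_sub_pow_le_of_norm_le {𝔸 : Type*} [NormedRing 𝔸] [NormOneClass 𝔸] {a b : 𝔸} {M : ℝ}
    (hM : 1 ≤ M) (ha : ‖a‖ ≤ M) (hb : ‖b‖ ≤ M) (m : ℕ) :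
    ‖a ^ m - b ^ m‖ ≤ m * ‖a - b‖ * M ^ m := by
  have hM0 : 0 ≤ M := zero_le_one.trans hM
  induction m with
  | zero => simp
  | succ m ih =>
    have h : a ^ (m + 1) - b ^ (m + 1) = a ^ m * (a - b) + (a ^ m - b ^ m) * b := by
      rw [pow_succ, pow_succ]; noncomm_ring
    have h1 : ‖a ^ m * (a - b)‖ ≤ ‖a - b‖ * M ^ (m + 1) := by
      calc ‖a ^ m * (a - b)‖ ≤ ‖a ^ m‖ * ‖a - b‖ := norm_mul_le _ _
        _ ≤ M ^ m * ‖a - b‖ := by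
          gcongr; exact (norm_pow_le _ _).trans (pow_le_pow_left₀ (norm_nonneg _) ha _)
        _ ≤ M ^ (m + 1) * ‖a - b‖ := by gcongr; exact Nat.le_succ m
        _ = _ := mul_comm _ _
    have h2 : ‖(a ^ m - b ^ m) * b‖ ≤ m * ‖a - b‖ * M ^ (m + 1) := by
      calc ‖(a ^ m - b ^ m) * b‖ ≤ ‖a ^ m - b ^ m‖ * ‖b‖ := norm_mul_le _ _
        _ ≤ (m * ‖a - b‖ * M ^ m) * M := by gcongr
        _ = _ := by ring
    rw [h]
    refine (norm_add_le _ _).trans ((add_le_add h1 h2).trans (le_of_eq ?_))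
    push_cast; ring

/-- Since exp(Y_k)^{m_k} = exp(m_k Y_k) already tends to exp Z, only the replacement of exp(Y_k) by
1 + Y_k has to be paid for. It costs m_k · o(‖Y_k‖) up to a bounded factor, and m_k‖Y_k‖ is bounded.
-/
theorem tendsto_one_add_pow_exp {𝔸 : Type*} [NormedRing 𝔸] [NormOneClass 𝔸] [NormedAlgebra ℝ 𝔸]
    [CompleteSpace 𝔸] {Y : ℕ → 𝔸} {Z : 𝔸} {m : ℕ → ℕ} (hY : Tendsto Y atTop (𝓝 0))
    (hZ : Tendsto (fun k => (m k : ℝ) • Y k) atTop (𝓝 Z)) :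
    Tendsto (fun k => (1 + Y k) ^ m k) atTop (𝓝 (NormedSpace.exp Z)) := by
  let : NormedAlgebra ℚ 𝔸 := NormedAlgebra.restrictScalars ℚ ℝ 𝔸
  have hexp : Tendsto (fun k => NormedSpace.exp (Y k) ^ m k) atTop (𝓝 (NormedSpace.exp Z)) := by
    refine hZ.exp.congr fun k => ?_
    rw [← NormedSpace.exp_nsmul, Nat.cast_smul_eq_nsmul]
  have ho : (fun k => NormedSpace.exp (Y k) - 1 - Y k) =o[atTop] Y := by
    have := (hasFDerivAt_iff_isLittleO_nhds_zero.mp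
      (hasFDerivAt_exp_zero (𝕂 := ℝ) (𝔸 := 𝔸))).comp_tendsto hY
    simpa [Function.comp_def] using this
  -- The exponent 2‖Y k‖ covers ‖Y k‖ itself and the remainder, eventually at most ‖Y k‖.
  have hb : ∀ᶠ k in atTop, ‖NormedSpace.exp (Y k)‖ ≤ Real.exp (2 * ‖Y k‖) := by
    filter_upwards [ho.bound one_pos] with k hk
    have : NormedSpace.exp (Y k) = (NormedSpace.exp (Y k) - 1 - Y k) + 1 + Y k := by abel
    rw [this]
    have h3 := norm_add₃_le (a := NormedSpace.exp (Y k) - 1 - Y k) (b := 1) (c := Y k)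
    rw [norm_one] at h3
    linarith [Real.add_one_le_exp (2 * ‖Y k‖)]
  have hn : Tendsto (fun k => (m k : ℝ) * ‖Y k‖) atTop (𝓝 ‖Z‖) := by
    refine hZ.norm.congr fun k => ?_
    rw [norm_smul, Real.norm_natCast]
  have hd : Tendsto (fun k => (m k : ℝ) * ‖1 + Y k - NormedSpace.exp (Y k)‖) atTop (𝓝 0) := by
    have h1 : (fun k => (m k : ℝ) * ‖1 + Y k - NormedSpace.exp (Y k)‖) =o[atTop]
        fun k => (m k : ℝ) * ‖Y k‖ := by
      refine (Asymptotics.isBigO_refl (fun k => (m k : ℝ)) atTop).mul_isLittleO ?_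
      refine (ho.norm_norm).congr_left fun k => ?_
      rw [← norm_neg]; congr 1; abel
    exact (h1.trans_isBigO (hn.isBigO_one ℝ)).tendsto_zero_of_tendsto tendsto_const_nhds
  have hbound : ∀ᶠ k in atTop, ‖(1 + Y k) ^ m k - NormedSpace.exp (Y k) ^ m k‖ ≤
      (m k : ℝ) * ‖1 + Y k - NormedSpace.exp (Y k)‖ * Real.exp (2 * ((m k : ℝ) * ‖Y k‖)) := by
    filter_upwards [hb] with k hk
    have h1 : ‖1 + Y k‖ ≤ Real.exp (2 * ‖Y k‖) := by
      have := norm_add_le 1 (Y k)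
      rw [norm_one] at this
      linarith [Real.add_one_le_exp (2 * ‖Y k‖), norm_nonneg (Y k)]
    refine (norm_pow_sub_pow_le_of_norm_le (Real.one_le_exp (by positivity)) h1 hk (m k)).trans ?_
    rw [← Real.exp_nat_mul]
    apply le_of_eq; congr 2; ring
  have hz : Tendsto (fun k => (m k : ℝ) * ‖1 + Y k - NormedSpace.exp (Y k)‖ *
      Real.exp (2 * ((m k : ℝ) * ‖Y k‖))) atTop (𝓝 0) := by
    simpa using hd.mul ((Real.continuous_exp.tendsto _).comp (hn.const_mul 2))
  have := (squeeze_zero_norm' hbound hz).add hexp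
  simpa using this

theorem tendsto_pow_floor_exp {𝔸 : Type*} [NormedRing 𝔸] [NormOneClass 𝔸] [NormedAlgebra ℝ 𝔸]
    [CompleteSpace 𝔸] {g : ℕ → 𝔸} {r : ℕ → ℝ} {X : 𝔸} (hr : Tendsto r atTop atTop)
    (hX : Tendsto (fun k => r k • (g k - 1)) atTop (𝓝 X)) {t : ℝ} (ht : 0 ≤ t) :
    Tendsto (fun k => g k ^ ⌊t * r k⌋₊) atTop (𝓝 (NormedSpace.exp (t • X))) := by
  have hg : Tendsto (fun k => g k - 1) atTop (𝓝 0) := by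
    have := (tendsto_inv_atTop_zero.comp hr).smul hX
    rw [zero_smul] at this
    refine this.congr' ?_
    filter_upwards [hr.eventually_gt_atTop 0] with k hk
    simp [smul_smul, hk.ne']
  have hm : Tendsto (fun k => (⌊t * r k⌋₊ : ℝ) / r k) atTop (𝓝 t) :=
    (tendsto_nat_floor_mul_div_atTop ht).comp hr
  have := tendsto_one_add_pow_exp hg (m := fun k => ⌊t * r k⌋₊) (Z := t • X) (by
    refine (hm.smul hX).congr' ?_
    filter_upwards [hr.eventually_gt_atTop 0] with k hk
    rw [smul_smul, div_mul_cancel₀ _ hk.ne'])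
  simpa using this

end FibBraid

namespace FibBraid

open Matrix Filter Topology

/-! ### The tangent space of a closed group of unitary matrices. -/

section LieAlgebra

open scoped Matrix.Norms.L2Operator

variable {ι : Type} [Fintype ι] [DecidableEq ι]

/-- The generators of the one-parameter subgroups contained in a set of matrices. -/
def tangent (C : Submonoid (Matrix ι ι ℂ)) : Set (Matrix ι ι ℂ) :=
  {X | ∀ t : ℝ, NormedSpace.exp (t • X) ∈ C}

theorem exp_smul_mul_exp_neg_smul (X : Matrix ι ι ℂ) (t : ℝ) :
    NormedSpace.exp (t • X) * NormedSpace.exp ((-t) • X) = 1 := by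
  let : NormedAlgebra ℚ (Matrix ι ι ℂ) := NormedAlgebra.restrictScalars ℚ ℝ _
  rw [← NormedSpace.exp_add_of_commute (((Commute.refl X).smul_left t).smul_right (-t)),
    ← add_smul, add_neg_cancel, zero_smul, NormedSpace.exp_zero]

/-- Limits of powers reach only t ≥ 0. For t < 0 the exponential is the inverse, that is the
adjoint, of one already in `C`. -/
theorem mem_tangent_of_tendsto [Nonempty ι] {C : Submonoid (Matrix ι ι ℂ)}
    (hcl : IsClosed (C : Set (Matrix ι ι ℂ))) (hstar : ∀ g ∈ C, star g ∈ C)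
    (hU : C ≤ unitaryGroup ι ℂ) {g : ℕ → Matrix ι ι ℂ} (hg : ∀ k, g k ∈ C) {r : ℕ → ℝ}
    (hr : Tendsto r atTop atTop) {X : Matrix ι ι ℂ}
    (hX : Tendsto (fun k => r k • (g k - 1)) atTop (𝓝 X)) : X ∈ tangent C := by
  have hpos : ∀ t : ℝ, 0 ≤ t → NormedSpace.exp (t • X) ∈ C := fun t ht =>
    hcl.mem_of_tendsto (tendsto_pow_floor_exp hr hX ht) (Eventually.of_forall fun k =>
      C.pow_mem (hg k) _)
  intro t
  rcases le_total 0 t with ht | ht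
  · exact hpos t ht
  · have h1 := hpos (-t) (by linarith)
    have h2 : NormedSpace.exp (t • X) = star (NormedSpace.exp ((-t) • X)) := by
      have h3 := mem_unitaryGroup_iff.mp (hU h1)
      rw [← mul_one (NormedSpace.exp (t • X)), ← h3, ← mul_assoc, exp_smul_mul_exp_neg_smul,
        one_mul]
    rw [h2]
    exact hstar _ h1

theorem zero_mem_tangent (C : Submonoid (Matrix ι ι ℂ)) : (0 : Matrix ι ι ℂ) ∈ tangent C := by
  intro t
  rw [smul_zero, NormedSpace.exp_zero]
  exact C.one_mem

theorem smul_mem_tangent {C : Submonoid (Matrix ι ι ℂ)} {X : Matrix ι ι ℂ} (hX : X ∈ tangent C)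
    (r : ℝ) : r • X ∈ tangent C := fun t => by
  rw [smul_smul]; exact hX _

/-- X + Y is the derivative at 0 of the curve exp(tX)exp(tY) in `C`, sampled at t = 1/(k+1). -/
theorem add_mem_tangent [Nonempty ι] {C : Submonoid (Matrix ι ι ℂ)}
    (hcl : IsClosed (C : Set (Matrix ι ι ℂ))) (hstar : ∀ g ∈ C, star g ∈ C)
    (hU : C ≤ unitaryGroup ι ℂ) {X Y : Matrix ι ι ℂ} (hX : X ∈ tangent C) (hY : Y ∈ tangent C) :
    X + Y ∈ tangent C := by
  have hd := (hasDerivAt_exp_smul_const (𝕂 := ℝ) X (0 : ℝ)).mul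
    (hasDerivAt_exp_smul_const (𝕂 := ℝ) Y (0 : ℝ))
  rw [hasDerivAt_iff_tendsto_slope_zero] at hd
  have hr : Tendsto (fun k : ℕ => (k : ℝ) + 1) atTop atTop :=
    tendsto_atTop_add_const_right _ _ tendsto_natCast_atTop_atTop
  have h0 : Tendsto (fun k : ℕ => ((k : ℝ) + 1)⁻¹) atTop (𝓝[≠] 0) := by
    refine tendsto_nhdsWithin_iff.mpr ⟨tendsto_inv_atTop_zero.comp hr, Eventually.of_forall ?_⟩
    intro k
    simp only [Set.mem_compl_iff, Set.mem_singleton_iff]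
    positivity
  have h1 := hd.comp h0
  refine mem_tangent_of_tendsto hcl hstar hU (g := fun k : ℕ =>
    NormedSpace.exp (((k : ℝ) + 1)⁻¹ • X) * NormedSpace.exp (((k : ℝ) + 1)⁻¹ • Y))
    (fun k => C.mul_mem (hX _) (hY _)) hr ?_
  simpa [Function.comp_def] using h1

/-- `g` need only normalize `C`: a crossing itself need not have determinant one. -/
theorem conj_mem_tangent {C : Submonoid (Matrix ι ι ℂ)} {X g : Matrix ι ι ℂ}
    (hg : g ∈ unitaryGroup ι ℂ) (hgC : ∀ Y ∈ C, g * Y * star g ∈ C) (hX : X ∈ tangent C) :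
    g * X * star g ∈ tangent C := by
  intro t
  have hinv : g⁻¹ = star g := inv_eq_right_inv (mem_unitaryGroup_iff.mp hg)
  have hu : IsUnit g := IsUnit.of_mul_eq_one _ (mem_unitaryGroup_iff.mp hg)
  have : t • (g * X * star g) = g * (t • X) * g⁻¹ := by rw [hinv]; simp
  rw [this, Matrix.exp_conj _ _ hu, hinv]
  exact hgC _ (hX t)

theorem star_eq_neg_of_mem_tangent {C : Submonoid (Matrix ι ι ℂ)} (hU : C ≤ unitaryGroup ι ℂ)
    {X : Matrix ι ι ℂ} (hX : X ∈ tangent C) : star X = -X := by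
  have hd := (hasDerivAt_exp_smul_const (𝕂 := ℝ) X (0 : ℝ)).mul
    (hasDerivAt_exp_smul_const (𝕂 := ℝ) (star X) (0 : ℝ))
  have hc : ∀ t : ℝ, NormedSpace.exp (t • X) * NormedSpace.exp (t • star X) = 1 := by
    intro t
    have h := mem_unitaryGroup_iff.mp (hU (hX t))
    rwa [NormedSpace.star_exp, star_smul, star_trivial] at h
  have h0 : HasDerivAt ((fun t : ℝ => NormedSpace.exp (t • X)) *
      fun t : ℝ => NormedSpace.exp (t • star X)) 0 (0 : ℝ) := by
    rw [show ((fun t : ℝ => NormedSpace.exp (t • X)) *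
      fun t : ℝ => NormedSpace.exp (t • star X)) = fun _ => 1 from funext hc]
    exact hasDerivAt_const _ _
  have := hd.unique h0
  simp at this
  exact eq_neg_of_add_eq_zero_right this

/-- Taking determinants gives exp(tNz) = 1 for all t, where N is the size; differentiate at 0. So a
nonzero tangent vector is never scalar. -/
theorem eq_zero_of_smul_one_mem_tangent [Nonempty ι] {C : Submonoid (Matrix ι ι ℂ)}
    (hSU : C ≤ specialUnitaryGroup ι ℂ) {z : ℂ}
    (hz : z • (1 : Matrix ι ι ℂ) ∈ tangent C) : z = 0 := by
  have h : ∀ t : ℝ, NormedSpace.exp (t • ((Fintype.card ι : ℂ) * z)) = 1 := by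
    intro t
    have h1 := (mem_specialUnitaryGroup_iff.mp (hSU (hz t))).2
    have h2 : t • z • (1 : Matrix ι ι ℂ) = algebraMap ℂ _ (t • z) := by
      rw [← smul_assoc, Algebra.algebraMap_eq_smul_one]
    rw [h2, ← NormedSpace.algebraMap_exp_comm, algebraMap_eq_diagonal, det_diagonal] at h1
    simp only [Pi.algebraMap_apply, Algebra.algebraMap_self_apply, Finset.prod_const,
      Finset.card_univ] at h1
    rw [← Complex.exp_eq_exp_ℂ] at h1 ⊢
    rw [← h1, ← Complex.exp_nat_mul]
    congr 1
    simp only [Complex.real_smul]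
    ring
  have hd := hasDerivAt_exp_smul_const (𝕂 := ℝ) ((Fintype.card ι : ℂ) * z) (0 : ℝ)
  have h0 : HasDerivAt (fun t : ℝ => NormedSpace.exp (t • ((Fintype.card ι : ℂ) * z)))
        0 (0 : ℝ) := by
    rw [funext h]; exact hasDerivAt_const _ _
  simpa using hd.unique h0

/-- By compactness a subsequence of the powers of V converges, so quotients of consecutive terms
tend to 1 without being 1. Their differences from 1, rescaled to norm one, accumulate at a tangent
vector of norm one. -/
theorem exists_ne_zero_mem_tangent [Nonempty ι] {C : Submonoid (Matrix ι ι ℂ)}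
    (hcl : IsClosed (C : Set (Matrix ι ι ℂ))) (hstar : ∀ g ∈ C, star g ∈ C)
    (hU : C ≤ unitaryGroup ι ℂ) {V : Matrix ι ι ℂ} (hV : V ∈ C) (hinf : ∀ k, 0 < k → V ^ k ≠ 1) :
    ∃ X ∈ tangent C, X ≠ 0 := by
  obtain ⟨W, -, φ, hφ, hW⟩ := tendsto_subseq_of_bounded
    (Metric.isBounded_closedBall (x := (0 : Matrix ι ι ℂ)) (r := 1)) (x := fun k => V ^ k)
    (fun k => by
      rw [mem_closedBall_zero_iff]
      exact (CStarRing.norm_of_mem_unitary (hU (C.pow_mem hV k))).le)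
  set g : ℕ → Matrix ι ι ℂ := fun k => V ^ (φ (k + 1) - φ k) with hg
  have hgC : ∀ k, g k ∈ C := fun k => C.pow_mem hV _
  have hg1 : ∀ k, g k - 1 ≠ 0 := fun k =>
    sub_ne_zero.mpr (hinf _ (Nat.sub_pos_of_lt (hφ (Nat.lt_succ_self k))))
  have hgt : Tendsto (fun k => g k - 1) atTop (𝓝 0) := by
    have h1 : Tendsto (fun k => V ^ φ (k + 1) - V ^ φ k) atTop (𝓝 0) := by
      simpa using (hW.comp (tendsto_add_atTop_nat 1)).sub hW
    rw [tendsto_zero_iff_norm_tendsto_zero] at h1 ⊢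
    refine h1.congr fun k => ?_
    have h2 : V ^ φ (k + 1) - V ^ φ k = V ^ φ k * (g k - 1) := by
      rw [mul_sub, mul_one, hg, ← pow_add, Nat.add_sub_cancel' (hφ (Nat.lt_succ_self k)).le]
    rw [h2]
    exact CStarRing.norm_mem_unitary_mul _ (hU (C.pow_mem hV _))
  obtain ⟨X, hXs, ψ, hψ, hX⟩ := (isCompact_sphere (0 : Matrix ι ι ℂ) 1).tendsto_subseq
    (x := fun k => ‖g k - 1‖⁻¹ • (g k - 1)) (fun k => by
      rw [mem_sphere_zero_iff_norm, norm_smul, norm_inv, norm_norm,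
        inv_mul_cancel₀ (norm_ne_zero_iff.mpr (hg1 k))])
  refine ⟨X, mem_tangent_of_tendsto hcl hstar hU (g := g ∘ ψ) (fun k => hgC _)
    (r := fun k => ‖g (ψ k) - 1‖⁻¹) ?_ hX, ?_⟩
  · refine tendsto_inv_nhdsGT_zero.comp (tendsto_nhdsWithin_iff.mpr ⟨?_, ?_⟩)
    · simpa using (hgt.comp hψ.tendsto_atTop).norm
    · exact Eventually.of_forall fun k => norm_pos_iff.mpr (hg1 _)
  · rintro rfl
    simp at hXs

/-- A unitary matrix is the exponential of a skew-Hermitian one. -/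
theorem exists_exp_eq_of_mem_unitary {V : Matrix ι ι ℂ} (hV : V ∈ unitaryGroup ι ℂ) :
    ∃ H : Matrix ι ι ℂ, IsSelfAdjoint H ∧ NormedSpace.exp (Complex.I • H) = V := by
  -- The spectrum is finite, so even the discontinuous `Complex.arg` is admissible in the functional
  -- calculus.
  have hc : ∀ f : ℂ → ℂ, ContinuousOn f (spectrum ℂ V) :=
    fun f => (finite_spectrum V).continuousOn f
  have : IsStarNormal V := by
    constructor
    rw [commute_iff_eq, mem_unitaryGroup_iff.mp hV, mem_unitaryGroup_iff'.mp hV]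
  refine ⟨cfc (Complex.arg · : ℂ → ℂ) V, IsSelfAdjoint.cfc_arg V, ?_⟩
  have hsa : IsSelfAdjoint (cfc (Complex.arg · : ℂ → ℂ) V) := IsSelfAdjoint.cfc_arg V
  have hexp : Continuous (NormedSpace.exp : ℂ → ℂ) := by
    rw [← Complex.exp_eq_exp_ℂ]; exact Complex.continuous_exp
  rw [← CFC.exp_eq_normedSpace_exp (𝕜 := ℂ) (ha := hsa.isStarNormal.smul _),
    ← cfc_comp_smul Complex.I NormedSpace.exp _ hexp.continuousOn hsa.isStarNormal,
    ← cfc_comp' (fun x => NormedSpace.exp (Complex.I • x)) (Complex.arg · : ℂ → ℂ) V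
      (by fun_prop) (hc _)]
  conv_rhs => rw [← cfc_id' ℂ V]
  refine cfc_congr fun y hy => ?_
  have hy₁ : ‖y‖ = 1 := spectrum.norm_eq_one_of_unitary hV hy
  have : Complex.I * y.arg = Complex.log y :=
    Complex.ext (by simp [Complex.log_re, hy₁]) (by simp [Complex.log_im])
  have hy0 : y ≠ 0 := by rintro rfl; simp at hy₁
  simpa [← Complex.exp_eq_exp_ℂ, this] using Complex.exp_log hy0
end LieAlgebra

end FibBraid

namespace FibBraid

open Matrix Filter Topology

/-! ### Density from an irreducible conjugation action and an element of infinite order. -/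

/-- Every subspace of matrices that is stable under conjugation by the given unitary matrices, and
is not made of scalar matrices only, contains all matrices of trace zero. -/
def AdIrreducible {ι : Type} [Fintype ι] [DecidableEq ι] (S : Set (Matrix ι ι ℂ)) : Prop :=
  ∀ U : Submodule ℂ (Matrix ι ι ℂ), (∀ g ∈ S, ∀ X ∈ U, g * X * star g ∈ U) →
    (∃ X ∈ U, ∀ z : ℂ, X ≠ z • 1) → ∀ X : Matrix ι ι ℂ, X.trace = 0 → X ∈ U

/-- Some quotient of two of the given unitary matrices has infinite order modulo scalars. -/
def HasInfiniteOrder {ι : Type} [Fintype ι] [DecidableEq ι] (S : Set (Matrix ι ι ℂ)) : Prop :=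
  ∃ g ∈ S, ∃ h ∈ S, ∀ k : ℕ, 0 < k → ∀ z : ℂ, (g * star h) ^ k ≠ z • 1

theorem exists_norm_eq_one_pow_eq {z : ℂ} (hz : ‖z‖ = 1) {N : ℕ} (hN : N ≠ 0) :
    ∃ w : ℂ, ‖w‖ = 1 ∧ w ^ N = z := by
  obtain ⟨w, hw⟩ := IsAlgClosed.exists_pow_nat_eq z (Nat.pos_of_ne_zero hN)
  exact ⟨w, (pow_eq_one_iff_of_nonneg (norm_nonneg w) hN).mp (by rw [← norm_pow, hw, hz]), hw⟩

section

variable {ι : Type} [Fintype ι] [DecidableEq ι]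

theorem norm_det_of_mem_unitaryGroup {U : Matrix ι ι ℂ} (hU : U ∈ unitaryGroup ι ℂ) :
    ‖U.det‖ = 1 := CStarRing.norm_of_mem_unitary (det_of_mem_unitary hU)

/-- A unitary matrix can be multiplied by a phase so as to have determinant one. -/
theorem exists_phase_smul_mem [Nonempty ι] {U : Matrix ι ι ℂ} (hU : U ∈ unitaryGroup ι ℂ) :
    ∃ w : ℂ, ‖w‖ = 1 ∧ w • U ∈ specialUnitaryGroup ι ℂ := by
  obtain ⟨w, hw, hwd⟩ := exists_norm_eq_one_pow_eq (z := (U.det)⁻¹)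
    (by rw [norm_inv, norm_det_of_mem_unitaryGroup hU, inv_one]) (Fintype.card_ne_zero (α := ι))
  refine ⟨w, hw, mem_specialUnitaryGroup_iff.mpr ⟨?_, ?_⟩⟩
  · have hww : w * star w = 1 := by
      rw [Complex.star_def, Complex.mul_conj, Complex.normSq_eq_norm_sq, hw]; simp
    rw [mem_unitaryGroup_iff, star_smul, smul_mul_smul_comm, hww, mem_unitaryGroup_iff.mp hU,
      one_smul]
  · rw [det_smul, hwd, inv_mul_cancel₀]
    intro h
    have := norm_det_of_mem_unitaryGroup hU
    simp [h] at this

theorem smul_mul_mul_star_smul {w : ℂ} (hw : ‖w‖ = 1) (g X : Matrix ι ι ℂ) :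
    (w • g) * X * star (w • g) = g * X * star g := by
  have hww : w * star w = 1 := by
    rw [Complex.star_def, Complex.mul_conj, Complex.normSq_eq_norm_sq, hw]; simp
  rw [star_smul, smul_mul_assoc, smul_mul_smul_comm, hww, one_smul]

/-- A closed group of special unitary matrices that contains the scalar ones, is normalized by
`S`, and has an element of infinite order, is everything if `S` acts irreducibly on the matrices
of trace zero. -/
theorem mem_of_adIrreducible [Nonempty ι] {C : Submonoid (Matrix ι ι ℂ)}
    (hcl : IsClosed (C : Set (Matrix ι ι ℂ))) (hstar : ∀ g ∈ C, star g ∈ C)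
    (hSU : C ≤ specialUnitaryGroup ι ℂ)
    (hscal : ∀ z : ℂ, z • (1 : Matrix ι ι ℂ) ∈ specialUnitaryGroup ι ℂ → z • 1 ∈ C)
    {S : Set (Matrix ι ι ℂ)} (hS : AdIrreducible S) (hSmem : ∀ g ∈ S, g ∈ unitaryGroup ι ℂ)
    (hSC : ∀ g ∈ S, ∀ Y ∈ C, g * Y * star g ∈ C)
    {V : Matrix ι ι ℂ} (hV : V ∈ C) (hinf : ∀ k, 0 < k → V ^ k ≠ 1)
    {W : Matrix ι ι ℂ} (hW : W ∈ specialUnitaryGroup ι ℂ) : W ∈ C := by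
  have hU : C ≤ unitaryGroup ι ℂ := hSU.trans specialUnitaryGroup_le_unitaryGroup
  -- The complex span of the tangent space, since irreducibility concerns complex subspaces.
  let T : Submodule ℂ (Matrix ι ι ℂ) :=
    { carrier := {Z | ∃ X ∈ tangent C, ∃ Y ∈ tangent C, Z = X + Complex.I • Y}
      zero_mem' := ⟨0, zero_mem_tangent C, 0, zero_mem_tangent C, by simp⟩
      add_mem' := by
        rintro _ _ ⟨X, hX, Y, hY, rfl⟩ ⟨X', hX', Y', hY', rfl⟩
        exact ⟨X + X', add_mem_tangent hcl hstar hU hX hX', Y + Y',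
          add_mem_tangent hcl hstar hU hY hY', by rw [smul_add]; abel⟩
      smul_mem' := by
        rintro c _ ⟨X, hX, Y, hY, rfl⟩
        refine ⟨c.re • X + (-c.im) • Y, add_mem_tangent hcl hstar hU (smul_mem_tangent hX _)
          (smul_mem_tangent hY _), c.im • X + c.re • Y,
          add_mem_tangent hcl hstar hU (smul_mem_tangent hX _) (smul_mem_tangent hY _), ?_⟩
        ext i j
        simp only [Matrix.smul_apply, Matrix.add_apply, smul_eq_mul, Complex.real_smul]
        conv_lhs => rw [← Complex.re_add_im c]
        push_cast
        linear_combination (c.im : ℂ) * Y i j * Complex.I_mul_I }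
  have hT : ∀ X : Matrix ι ι ℂ, X.trace = 0 → X ∈ T := by
    refine hS T ?_ ?_
    · rintro g hg _ ⟨X, hX, Y, hY, rfl⟩
      exact ⟨_, conj_mem_tangent (hSmem g hg) (hSC g hg) hX, _,
        conj_mem_tangent (hSmem g hg) (hSC g hg) hY, by simp [mul_add, add_mul]⟩
    · obtain ⟨X, hX, hX0⟩ := exists_ne_zero_mem_tangent hcl hstar hU hV hinf
      refine ⟨X, ⟨X, hX, 0, zero_mem_tangent C, by simp⟩, ?_⟩
      rintro z rfl
      exact hX0 (by rw [eq_zero_of_smul_one_mem_tangent hSU hX, zero_smul])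
  have hskew : ∀ Z : Matrix ι ι ℂ, Z.trace = 0 → star Z = -Z → Z ∈ tangent C := by
    intro Z hZ hZs
    obtain ⟨X, hX, Y, hY, h⟩ := hT Z hZ
    have hXs := star_eq_neg_of_mem_tangent hU hX
    have hYs := star_eq_neg_of_mem_tangent hU hY
    have h1 : star Z = -X + Complex.I • Y := by
      rw [h, star_add, star_smul, hXs, hYs, Complex.star_def, Complex.conj_I]
      simp
    -- X and Y are skew-Hermitian, so iY is Hermitian, and 2Z = Z - Z* = 2X.
    have h2 : Z = X := by
      have h3 : Z + Z = X + X := by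
        have : Z + star Z = 0 := by rw [hZs]; abel
        calc Z + Z = Z - star Z + (Z + star Z) := by abel
          _ = X + X := by rw [this, h1, h]; abel
      ext i j
      have := congrFun (congrFun h3 i) j
      simp only [Matrix.add_apply] at this
      linear_combination this / 2
    rwa [h2]
  obtain ⟨H, hH, rfl⟩ := exists_exp_eq_of_mem_unitary (specialUnitaryGroup_le_unitaryGroup hW)
  -- Subtracting the mean eigenvalue makes H traceless; the phase exp(ix) is handled by `hscal`.
  set x : ℂ := H.trace / Fintype.card ι with hx
  have hcard : (Fintype.card ι : ℂ) ≠ 0 := Nat.cast_ne_zero.mpr Fintype.card_ne_zero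
  have hxs : star x = x := by
    rw [hx, star_div₀, ← trace_conjTranspose, ← star_eq_conjTranspose, hH.star_eq]
    simp
  have hZ : NormedSpace.exp (Complex.I • (H - x • 1)) ∈ C := by
    have := hskew (Complex.I • (H - x • 1)) (by
      rw [trace_smul, trace_sub, trace_smul, trace_one, hx, smul_eq_mul (H.trace / _),
        div_mul_cancel₀ _ hcard, sub_self, smul_zero]) (by
      rw [star_smul, star_sub, hH.star_eq, star_smul, hxs, star_one, Complex.star_def,
        Complex.conj_I, neg_smul]) 1
    rwa [one_smul] at this
  have hfac : NormedSpace.exp (Complex.I • H) = (Complex.exp (Complex.I * x) • 1) *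
      NormedSpace.exp (Complex.I • (H - x • 1)) := by
    have h1 : NormedSpace.exp ((Complex.I * x) • (1 : Matrix ι ι ℂ)) =
        Complex.exp (Complex.I * x) • 1 := by
      rw [smul_one_eq_diagonal, exp_diagonal, smul_one_eq_diagonal, Complex.exp_eq_exp_ℂ]
      congr 1
      funext i
      exact Pi.coe_exp _ i
    rw [← h1, ← exp_add_of_commute _ _ ((Commute.one_left _).smul_left _), smul_sub, smul_smul]
    congr 1; abel
  rw [hfac]
  refine C.mul_mem (hscal _ ?_) hZ
  -- The scalar factor is a quotient of two special unitary matrices, hence special unitary.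
  have h2 : Complex.exp (Complex.I * x) • (1 : Matrix ι ι ℂ) = NormedSpace.exp (Complex.I • H) *
      star (NormedSpace.exp (Complex.I • (H - x • 1))) := by
    rw [hfac, mul_assoc, mem_unitaryGroup_iff.mp (hU hZ), mul_one]
  rw [h2]
  exact Submonoid.mul_mem _ hW (hSU (hstar _ hZ))

theorem smul_one_mem_unitaryGroup_iff [Nonempty ι] {z : ℂ} :
    z • (1 : Matrix ι ι ℂ) ∈ unitaryGroup ι ℂ ↔ ‖z‖ = 1 := by
  have h : z • (1 : Matrix ι ι ℂ) * star (z • (1 : Matrix ι ι ℂ)) = ((‖z‖ : ℂ) ^ 2) • 1 := by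
    rw [star_smul, smul_mul_smul_comm, star_one, one_mul, Complex.star_def, Complex.mul_conj,
      Complex.normSq_eq_norm_sq, Complex.ofReal_pow]
  rw [mem_unitaryGroup_iff, h]
  constructor
  · intro h1
    have h2 := congrFun (congrFun h1 (Classical.arbitrary ι)) (Classical.arbitrary ι)
    simp only [Matrix.smul_apply, one_apply_eq, smul_eq_mul, mul_one] at h2
    have h3 : ‖z‖ ^ 2 = 1 := by exact_mod_cast h2
    exact (pow_eq_one_iff_of_nonneg (norm_nonneg z) two_ne_zero).mp h3
  · intro h1; simp [h1]

/-- The criterion is applied to the closure of the group inside all matrices. Multiplying an element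
of the image by a phase that makes its determinant one changes neither its conjugation action nor
whether its powers are scalar. -/
theorem denseModuloPhase_of_adIrreducible [Nonempty ι] {H : Type} [Group H]
    (ρ : H →* unitaryGroup ι ℂ) {S : Set (Matrix ι ι ℂ)}
    (hS : ∀ g ∈ S, ∃ h, (ρ h : Matrix ι ι ℂ) = g) (hirr : AdIrreducible S)
    (hinf : HasInfiniteOrder S) : DenseModuloPhase ρ := by
  set P := moduloPhase ρ.range with hP
  let C₀ : Submonoid (Matrix ι ι ℂ) := P.toSubmonoid.map (specialUnitaryGroup ι ℂ).subtype
  have hC₀ : ∀ (h : H) (w : ℂ), ‖w‖ = 1 → w • (ρ h : Matrix ι ι ℂ) ∈ specialUnitaryGroup ι ℂ →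
      w • (ρ h : Matrix ι ι ℂ) ∈ C₀ := fun h w hw hmem =>
    ⟨⟨_, hmem⟩, ⟨w, hw, ρ h, ⟨h, rfl⟩, rfl⟩, rfl⟩
  have hclSU : IsClosed (specialUnitaryGroup ι ℂ : Set (Matrix ι ι ℂ)) := by
    have h1 : IsClosed {A : Matrix ι ι ℂ | A * star A = 1} :=
      isClosed_eq (continuous_id.mul continuous_id.star) continuous_const
    have h2 : IsClosed {A : Matrix ι ι ℂ | A.det = 1} :=
      isClosed_eq (continuous_id.matrix_det) continuous_const
    convert h1.inter h2 using 1
    ext A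
    simp [mem_specialUnitaryGroup_iff, mem_unitaryGroup_iff]
  set C := C₀.topologicalClosure with hC
  have hcl : IsClosed (C : Set (Matrix ι ι ℂ)) := C₀.isClosed_topologicalClosure
  have hC₀SU : C₀ ≤ specialUnitaryGroup ι ℂ := by rintro _ ⟨V, -, rfl⟩; exact V.2
  have hSU : C ≤ specialUnitaryGroup ι ℂ := C₀.topologicalClosure_minimal hC₀SU hclSU
  have hle : C₀ ≤ C := C₀.le_topologicalClosure
  have hclos : ∀ f : Matrix ι ι ℂ → Matrix ι ι ℂ, Continuous f → (∀ Y ∈ C₀, f Y ∈ C₀) →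
      ∀ Y ∈ C, f Y ∈ C := fun f hf h Y hY =>
    map_mem_closure (t := (C₀ : Set (Matrix ι ι ℂ))) hf hY h
  have hstar : ∀ g ∈ C, star g ∈ C := hclos _ continuous_star (by
    rintro _ ⟨V, hV, rfl⟩
    exact ⟨V⁻¹, P.inv_mem hV, rfl⟩)
  have hSmem : ∀ g ∈ S, g ∈ unitaryGroup ι ℂ := fun g hg => by
    obtain ⟨h, rfl⟩ := hS g hg; exact (ρ h).2
  have hSC : ∀ g ∈ S, ∀ Y ∈ C, g * Y * star g ∈ C := by
    intro g hg
    refine hclos _ (by fun_prop) ?_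
    obtain ⟨h, rfl⟩ := hS g hg
    obtain ⟨w, hw, hmem⟩ := exists_phase_smul_mem (ρ h).2
    intro Y hY
    rw [← smul_mul_mul_star_smul hw]
    obtain ⟨V, hV, hVe⟩ := hC₀ h w hw hmem
    exact C₀.mul_mem (C₀.mul_mem (hC₀ h w hw hmem) hY)
      (by rw [← hVe]; exact ⟨V⁻¹, P.inv_mem hV, rfl⟩)
  have hscal : ∀ z : ℂ, z • (1 : Matrix ι ι ℂ) ∈ specialUnitaryGroup ι ℂ → z • 1 ∈ C := by
    intro z hz
    have hz1 := smul_one_mem_unitaryGroup_iff.mp (specialUnitaryGroup_le_unitaryGroup hz)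
    have h1 : ((ρ 1 : unitaryGroup ι ℂ) : Matrix ι ι ℂ) = 1 := by rw [map_one]; rfl
    have := hC₀ 1 z hz1
    rw [h1] at this
    exact hle (this hz)
  obtain ⟨g, hg, h, hh, hgh⟩ := hinf
  obtain ⟨x, rfl⟩ := hS g hg
  obtain ⟨y, rfl⟩ := hS h hh
  have hxy : ((ρ (x * y⁻¹) : unitaryGroup ι ℂ) : Matrix ι ι ℂ) =
      (ρ x : Matrix ι ι ℂ) * star (ρ y : Matrix ι ι ℂ) := by
    rw [map_mul, map_inv]; rfl
  obtain ⟨w, hw, hmem⟩ := exists_phase_smul_mem (ρ (x * y⁻¹)).2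
  have hV := hle (hC₀ _ w hw hmem)
  have hVinf : ∀ k, 0 < k → (w • ((ρ (x * y⁻¹) : unitaryGroup ι ℂ) : Matrix ι ι ℂ)) ^ k ≠ 1 := by
    intro k hk he
    rw [smul_pow, hxy] at he
    have hw0 : w ^ k ≠ 0 := pow_ne_zero _ (by rintro rfl; simp at hw)
    exact hgh k hk (w ^ k)⁻¹ (by rw [← he, smul_smul, inv_mul_cancel₀ hw0, one_smul])
  intro W
  rw [closure_subtype]
  exact mem_of_adIrreducible hcl hstar hSU hscal hirr hSmem hSC hV hVinf W.2

theorem denseModuloPhase_of_card_le_one {H : Type} [Group H] (ρ : H →* unitaryGroup ι ℂ)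
    (h : Fintype.card ι ≤ 1) : DenseModuloPhase ρ := by
  have : Subsingleton ι := Fintype.card_le_one_iff_subsingleton.mp h
  have hs : ∀ V : specialUnitaryGroup ι ℂ, V = 1 := by
    intro V
    apply Subtype.ext
    rcases isEmpty_or_nonempty ι with hι | ⟨⟨i⟩⟩
    · exact Subsingleton.elim _ _
    · ext j k
      have hd := (mem_specialUnitaryGroup_iff.mp V.2).2
      rw [det_eq_elem_of_subsingleton _ i] at hd
      rw [Subsingleton.elim j i, Subsingleton.elim k i, hd]
      simp
  intro V
  rw [hs V]
  exact subset_closure (one_mem _)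

end

end FibBraid

namespace FibBraid

open Matrix

/-! ### Stability under products, and relabelling of the basis. -/

section Stable

variable {ι : Type} [Fintype ι] [DecidableEq ι]

/-- This allows conjugation by a product of crossings that is not itself a crossing. -/
theorem conj_mem_of_mem_closure {S : Set (Matrix ι ι ℂ)} {U : Submodule ℂ (Matrix ι ι ℂ)}
    (hU : ∀ g ∈ S, ∀ X ∈ U, g * X * star g ∈ U) {g : Matrix ι ι ℂ} (hg : g ∈ Submonoid.closure S) :
    ∀ X ∈ U, g * X * star g ∈ U := by
  induction hg using Submonoid.closure_induction with
  | mem x hx => exact hU x hx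
  | one => intro X hX; simpa using hX
  | mul x y _ _ hx hy =>
    intro X hX
    have := hx _ (hy X hX)
    simpa only [star_mul, mul_assoc] using this

variable {κ : Type} [Fintype κ] [DecidableEq κ]

theorem AdIrreducible.submatrix {S : Set (Matrix ι ι ℂ)} (hS : AdIrreducible S) (e : κ ≃ ι)
    {S' : Set (Matrix κ κ ℂ)} (h : ∀ g ∈ S, g.submatrix e e ∈ S') : AdIrreducible S' := by
  intro U hU hX X hX0
  let r : Matrix κ κ ℂ ≃ₗ[ℂ] Matrix ι ι ℂ := reindexLinearEquiv ℂ ℂ e e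
  have hr : ∀ Y, r.symm Y = Y.submatrix e e := fun Y => rfl
  have := hS (U.comap r.symm.toLinearMap) (by
    intro g hg Y hY
    have := hU _ (h g hg) _ hY
    simp only [Submodule.mem_comap, LinearEquiv.coe_coe, hr] at this ⊢
    rwa [← submatrix_mul_equiv _ _ _ e, ← submatrix_mul_equiv _ _ _ e]) (by
    obtain ⟨Y, hY, hYs⟩ := hX
    refine ⟨r Y, by simpa using hY, fun z hz => hYs z ?_⟩
    rw [← r.symm_apply_apply Y, hz, hr]
    ext i j
    simp [one_apply]) (r X) (by
    rw [← hX0]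
    exact e.symm.sum_comp fun i => X i i)
  simpa using this

theorem HasInfiniteOrder.submatrix {S : Set (Matrix ι ι ℂ)} (hS : HasInfiniteOrder S) (e : κ ≃ ι)
    {S' : Set (Matrix κ κ ℂ)} (h : ∀ g ∈ S, g.submatrix e e ∈ S') : HasInfiniteOrder S' := by
  obtain ⟨g, hg, k, hk, hinf⟩ := hS
  refine ⟨_, h g hg, _, h k hk, fun n hn z hz => hinf n hn z ?_⟩
  have h1 : (g.submatrix e e * star (k.submatrix e e)) ^ n =
      ((g * star k) ^ n).submatrix e e := by
    rw [show star (k.submatrix e e) = (star k).submatrix e e from rfl, submatrix_mul_equiv]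
    exact (map_pow (reindexAlgEquiv ℂ ℂ e.symm) (g * star k) n).symm
  rw [h1] at hz
  have h2 := congrArg (fun A => A.submatrix e.symm e.symm) hz
  simp only [submatrix_submatrix, Equiv.self_comp_symm, submatrix_id_id] at h2
  rw [h2]
  ext i j
  simp [one_apply]

end Stable

/-! ### Stable subspaces of block matrices. -/

section Blocks

variable {α β : Type} [Fintype α] [DecidableEq α] [Fintype β] [DecidableEq β]

/-- Conjugation by diag(l, 1) has eigenvalue l on the upper right block, l⁻¹ on the lower left one
and 1 on the diagonal blocks. As l² ≠ 1 these are distinct, so a stable subspace is the sum of its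
eigenparts. -/
theorem fromBlocks_mem_of_conj_diagonal {U : Submodule ℂ (Matrix (α ⊕ β) (α ⊕ β) ℂ)} {l : ℂ}
    (hl : l * star l = 1) (hl2 : l ^ 2 ≠ 1)
    (hU : ∀ X ∈ U, fromBlocks (l • 1) 0 0 1 * X * star (fromBlocks (l • 1) 0 0 1) ∈ U)
    {P : Matrix α α ℂ} {Y : Matrix α β ℂ} {Y' : Matrix β α ℂ} {Z : Matrix β β ℂ}
    (h : fromBlocks P Y Y' Z ∈ U) :
    fromBlocks 0 Y 0 0 ∈ U ∧ fromBlocks 0 0 Y' 0 ∈ U ∧ fromBlocks P 0 0 Z ∈ U := by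
  have hconj : ∀ {P Y Y' Z}, fromBlocks P Y Y' Z ∈ U →
      fromBlocks P (l • Y) (star l • Y') Z ∈ U := by
    intro P Y Y' Z h
    have := hU _ h
    rw [star_eq_conjTranspose, fromBlocks_conjTranspose, fromBlocks_multiply,
      fromBlocks_multiply] at this
    simp only [conjTranspose_smul, conjTranspose_one, conjTranspose_zero, Matrix.smul_mul,
      Matrix.one_mul, Matrix.zero_mul, Matrix.mul_zero, add_zero, zero_add, Matrix.mul_one,
      Matrix.mul_smul, smul_smul] at this
    rwa [mul_comm (star l) l, hl, one_smul] at this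
  have hsub : ∀ {P Y Y' Z P₁ Y₁ Y₁' Z₁}, fromBlocks P Y Y' Z ∈ U → fromBlocks P₁ Y₁ Y₁' Z₁ ∈ U →
      fromBlocks (P - P₁) (Y - Y₁) (Y' - Y₁') (Z - Z₁) ∈ U := by
    intro P Y Y' Z P₁ Y₁ Y₁' Z₁ h h'
    have := U.sub_mem h h'
    rwa [sub_eq_add_neg, fromBlocks_neg, fromBlocks_add, ← sub_eq_add_neg, ← sub_eq_add_neg,
      ← sub_eq_add_neg, ← sub_eq_add_neg] at this
  have hl1 : l - 1 ≠ 0 := fun h0 => hl2 (by rw [sub_eq_zero.mp h0, one_pow])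
  have hll : l - star l ≠ 0 := fun h0 => hl2 (by
    rw [pow_two]; nth_rw 2 [sub_eq_zero.mp h0]; exact hl)
  have hl1' : star l - 1 ≠ 0 := fun h0 => hl1 (by
    have := congrArg star h0
    simpa using this)
  have h1 := hsub (hconj h) h
  rw [sub_self, sub_self] at h1
  -- Conjugating the difference and subtracting l⁻¹ times it kills the lower left block and leaves
  -- (l - l⁻¹)(l - 1)Y.
  have h2 : fromBlocks 0 Y 0 0 ∈ U := by
    have h3 := U.smul_mem ((l - star l) * (l - 1))⁻¹ (hsub (hconj h1) (by
      have := U.smul_mem (star l) h1; rwa [fromBlocks_smul] at this))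
    rw [fromBlocks_smul] at h3
    convert h3 using 2
    · simp
    · rw [← sub_smul, show l • Y - Y = (l - 1) • Y by rw [sub_smul, one_smul], smul_smul, smul_smul,
        mul_assoc, inv_mul_cancel₀ (mul_ne_zero hll hl1), one_smul]
    · simp
    · simp
  have h3 : fromBlocks 0 0 Y' 0 ∈ U := by
    have h4 := U.smul_mem (star l - 1)⁻¹ (hsub h1 (by
      have := U.smul_mem (l - 1) h2; rwa [fromBlocks_smul] at this))
    rw [fromBlocks_smul] at h4
    convert h4 using 2
    · simp
    · rw [sub_smul, one_smul, sub_self, smul_zero]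
    · rw [smul_zero, sub_zero, show star l • Y' - Y' = (star l - 1) • Y' by rw [sub_smul, one_smul],
        smul_smul, inv_mul_cancel₀ hl1', one_smul]
    · simp
  refine ⟨h2, h3, ?_⟩
  have := hsub (hsub h h2) h3
  simpa using this

omit [DecidableEq β] in
-- A Goursat argument by dimension. On the pairs (P, Z) of diagonal blocks in U, the map to (Z, tr
-- P) is injective, because Z = 0 forces P to be scalar and the trace detects scalars; so their
-- dimension is at most β² + 1. Projection to P covers the traceless matrices, so it is at least α²
-- - 1.
theorem card_sq_le_of_forall_exists [Nonempty α]
    {U : Submodule ℂ (Matrix (α ⊕ β) (α ⊕ β) ℂ)}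
    (hK : ∀ P : Matrix α α ℂ, fromBlocks P 0 0 0 ∈ U → ∃ z : ℂ, P = z • 1)
    (hA : ∀ P : Matrix α α ℂ, P.trace = 0 → ∃ Z : Matrix β β ℂ, fromBlocks P 0 0 Z ∈ U) :
    Fintype.card α ^ 2 ≤ Fintype.card β ^ 2 + 2 := by
  let f : Matrix α α ℂ × Matrix β β ℂ →ₗ[ℂ] Matrix (α ⊕ β) (α ⊕ β) ℂ :=
    { toFun := fun x => fromBlocks x.1 0 0 x.2
      map_add' := fun x y => by simp [fromBlocks_add]
      map_smul' := fun c x => by simp [fromBlocks_smul] }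
  let U₀ := U.comap f
  let G : U₀ →ₗ[ℂ] Matrix β β ℂ × ℂ :=
    ((LinearMap.snd ℂ _ _).prod ((traceLinearMap α ℂ ℂ).comp (LinearMap.fst ℂ _ _))).comp
      U₀.subtype
  have hG : Function.Injective G := by
    rw [← LinearMap.ker_eq_bot, LinearMap.ker_eq_bot']
    rintro ⟨⟨P, Z⟩, hPZ⟩ h
    have h1 : Z = 0 := congrArg Prod.fst h
    have h2 : P.trace = 0 := congrArg Prod.snd h
    subst h1
    obtain ⟨z, rfl⟩ := hK P hPZ
    have : z = 0 := by
      rw [trace_smul, trace_one, smul_eq_mul] at h2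
      exact (mul_eq_zero.mp h2).resolve_right (Nat.cast_ne_zero.mpr Fintype.card_ne_zero)
    subst this
    simp
  have h1 := LinearMap.finrank_le_finrank_of_injective hG
  rw [Module.finrank_prod, Module.finrank_matrix, Module.finrank_self] at h1
  let F : U₀ →ₗ[ℂ] Matrix α α ℂ := (LinearMap.fst ℂ _ _).comp U₀.subtype
  have h2 : Module.finrank ℂ (LinearMap.ker (traceLinearMap α ℂ ℂ)) ≤ Module.finrank ℂ U₀ := by
    refine le_trans (Submodule.finrank_mono ?_) (LinearMap.finrank_range_le F)
    intro P hP
    obtain ⟨Z, hZ⟩ := hA P hP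
    exact ⟨⟨(P, Z), hZ⟩, rfl⟩
  have h3 := LinearMap.finrank_range_add_finrank_ker (traceLinearMap α ℂ ℂ)
  have h4 := Submodule.finrank_le (LinearMap.range (traceLinearMap α ℂ ℂ))
  rw [Module.finrank_self] at h4
  rw [Module.finrank_matrix, Module.finrank_self] at h3
  nlinarith

variable {E E' : Matrix α α ℂ} {Q : Matrix α β ℂ} {c d : ℂ}

omit [DecidableEq α] in
theorem conj_fromBlocks (E : Matrix α α ℂ) (Q : Matrix α β ℂ) (c d : ℂ)
    (P : Matrix α α ℂ) (Y : Matrix α β ℂ) (Y' : Matrix β α ℂ)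
    (Z : Matrix β β ℂ) :
    (fromBlocks E (d • Q) (d • Qᴴ) (c • 1) * fromBlocks P Y Y' Z *
      star (fromBlocks E (d • Q) (d • Qᴴ) (c • 1))).toBlocks₁₁ =
    E * P * Eᴴ + star d • (E * Y * Qᴴ) + d • (Q * Y' * Eᴴ) + (d * star d) • (Q * Z * Qᴴ) := by
  rw [star_eq_conjTranspose, fromBlocks_conjTranspose, fromBlocks_multiply, fromBlocks_multiply,
    toBlocks_fromBlocks₁₁]
  simp only [conjTranspose_smul, Matrix.smul_mul, Matrix.mul_smul, Matrix.add_mul, smul_add,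
      smul_smul, mul_comm (star d) d]
  abel

omit [DecidableEq α] in
theorem conj_fromBlocks_offDiag (E : Matrix α α ℂ) (Q : Matrix α β ℂ) (c d : ℂ)
    (P : Matrix α α ℂ) : fromBlocks E (d • Q) (d • Qᴴ) (c • 1) * fromBlocks P 0 0 0 *
      star (fromBlocks E (d • Q) (d • Qᴴ) (c • 1)) =
    fromBlocks (E * P * Eᴴ) (star d • (E * P * Q)) (d • (Qᴴ * P * Eᴴ))
      ((d * star d) • (Qᴴ * P * Q)) := by
  rw [star_eq_conjTranspose, fromBlocks_conjTranspose, fromBlocks_multiply, fromBlocks_multiply]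
  simp only [conjTranspose_smul, conjTranspose_conjTranspose, Matrix.smul_mul, Matrix.mul_smul,
    Matrix.mul_zero, add_zero, Matrix.zero_mul, smul_smul, smul_zero, mul_comm (star d) d]

omit [DecidableEq α] [DecidableEq β] in
theorem trace_fromBlocks_eq_add (P : Matrix α α ℂ) (Y : Matrix α β ℂ) (Y' : Matrix β α ℂ)
    (Z : Matrix β β ℂ) :
    (fromBlocks P Y Y' Z).trace = P.trace + Z.trace := by
  simp [trace, Fintype.sum_sum_type]

/-- If the conjugation by a crossing is applied to a stable subspace containing all traceless
matrices of one diagonal block, all traceless matrices are reached. -/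
theorem mem_of_forall_fromBlocks_mem {U : Submodule ℂ (Matrix (α ⊕ β) (α ⊕ β) ℂ)}
    (hgrade : ∀ P Y Y' Z, fromBlocks P Y Y' Z ∈ U →
      fromBlocks 0 Y 0 0 ∈ U ∧ fromBlocks 0 0 Y' 0 ∈ U ∧ fromBlocks P 0 0 Z ∈ U)
    (hE : E * E' = 1) (hQ : Qᴴ * Q = 1) {f : α} (hf : ∀ b, Q f b = 0) (hd : d ≠ 0)
    (hσ : fromBlocks E (d • Q) (d • Qᴴ) (c • 1) ∈ unitaryGroup (α ⊕ β) ℂ)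
    (hU : ∀ X ∈ U, fromBlocks E (d • Q) (d • Qᴴ) (c • 1) * X *
      star (fromBlocks E (d • Q) (d • Qᴴ) (c • 1)) ∈ U)
    (hsl : ∀ P : Matrix α α ℂ, P.trace = 0 → fromBlocks P 0 0 0 ∈ U)
    (X : Matrix (α ⊕ β) (α ⊕ β) ℂ) (hX : X.trace = 0) : X ∈ U := by
  have hfQ : single f f (1 : ℂ) * Q = 0 := by
    ext i j
    by_cases hi : i = f
    · subst hi; simp [hf]
    · rw [single_mul_apply_of_ne _ _ _ _ _ hi]; rfl
  have hQf : Qᴴ * single f f (1 : ℂ) = 0 := by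
    have := congrArg conjTranspose hfQ
    simpa [conjTranspose_mul, conjTranspose_single] using this
  have hds : star d ≠ 0 := star_ne_zero.mpr hd
  have hE' : E'ᴴ * Eᴴ = 1 := by
    have := congrArg conjTranspose (mul_eq_one_comm.mp hE)
    rw [conjTranspose_mul, conjTranspose_one] at this
    exact mul_eq_one_comm.mp this
  -- P may be arbitrary: its trace is removed at the entry (f, f), and since row f of Q vanishes the
  -- blocks involving Q do not see this correction.
  have key : ∀ P : Matrix α α ℂ, fromBlocks 0 (star d • (E * P * Q)) 0 0 ∈ U ∧
      fromBlocks 0 0 (d • (Qᴴ * P * Eᴴ)) 0 ∈ U ∧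
      fromBlocks (E * (P - P.trace • single f f 1) * Eᴴ) 0 0 ((d * star d) • (Qᴴ * P * Q)) ∈ U := by
    intro P
    have h0 : (P - P.trace • single f f (1 : ℂ)).trace = 0 := by
      rw [trace_sub, trace_smul, trace_single_eq_same]; simp
    have h := hU _ (hsl _ h0)
    rw [conj_fromBlocks_offDiag] at h
    have h1 : E * (P - P.trace • single f f (1 : ℂ)) * Q = E * P * Q := by
      rw [Matrix.mul_sub, Matrix.sub_mul, Matrix.mul_assoc E (P.trace • _), Matrix.smul_mul,
        hfQ]
      simp
    have h2 : Qᴴ * (P - P.trace • single f f (1 : ℂ)) = Qᴴ * P := by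
      rw [Matrix.mul_sub, Matrix.mul_smul, hQf]; simp
    rw [h1, h2] at h
    exact hgrade _ _ _ _ h
  have hY : ∀ Y : Matrix α β ℂ, fromBlocks 0 Y 0 0 ∈ U := by
    intro Y
    have h := U.smul_mem (star d)⁻¹ (key (E' * Y * Qᴴ)).1
    rw [fromBlocks_smul, smul_smul, inv_mul_cancel₀ hds, one_smul] at h
    have : E * (E' * Y * Qᴴ) * Q = Y := by
      rw [show E * (E' * Y * Qᴴ) * Q = (E * E') * Y * (Qᴴ * Q) by simp only [Matrix.mul_assoc],
        hE, hQ, Matrix.one_mul, Matrix.mul_one]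
    simpa [this] using h
  have hY' : ∀ Y : Matrix β α ℂ, fromBlocks 0 0 Y 0 ∈ U := by
    intro Y
    have h := U.smul_mem d⁻¹ (key (Q * Y * E'ᴴ)).2.1
    rw [fromBlocks_smul, smul_smul, inv_mul_cancel₀ hd, one_smul] at h
    have : Qᴴ * (Q * Y * E'ᴴ) * Eᴴ = Y := by
      rw [show Qᴴ * (Q * Y * E'ᴴ) * Eᴴ = (Qᴴ * Q) * Y * (E'ᴴ * Eᴴ) by
        simp only [Matrix.mul_assoc], hE', hQ, Matrix.one_mul, Matrix.mul_one]
    simpa [this] using h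
  -- Only the trace of the accompanying block P matters, and it is known because conjugation by a
  -- unitary matrix preserves the trace 0.
  have hZ : ∀ Z : Matrix β β ℂ, ∃ P : Matrix α α ℂ, P.trace + Z.trace = 0 ∧
      fromBlocks P 0 0 Z ∈ U := by
    intro Z
    obtain ⟨W, hW⟩ : ∃ W : Matrix α α ℂ, W = (d * star d)⁻¹ • (Q * Z * Qᴴ) := ⟨_, rfl⟩
    have hWZ : (d * star d) • (Qᴴ * W * Q) = Z := by
      rw [hW, Matrix.mul_smul, Matrix.smul_mul, smul_smul, mul_inv_cancel₀ (mul_ne_zero hd hds),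
        one_smul, show Qᴴ * (Q * Z * Qᴴ) * Q = (Qᴴ * Q) * Z * (Qᴴ * Q) by
        simp only [Matrix.mul_assoc], hQ, Matrix.one_mul, Matrix.mul_one]
    refine ⟨_, ?_, by have := (key W).2.2; rwa [hWZ] at this⟩
    have h0 : (W - W.trace • single f f (1 : ℂ)).trace = 0 := by
      rw [trace_sub, trace_smul, trace_single_eq_same]; simp
    have h1 : Qᴴ * (W - W.trace • single f f (1 : ℂ)) = Qᴴ * W := by
      rw [Matrix.mul_sub, Matrix.mul_smul, hQf]; simp
    have h2 := congrArg trace (conj_fromBlocks_offDiag E Q c d (W - W.trace • single f f 1))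
    rw [trace_mul_comm, ← mul_assoc, mem_unitaryGroup_iff'.mp hσ, one_mul, trace_fromBlocks_eq_add,
      trace_fromBlocks_eq_add, h0, h1, hWZ] at h2
    simpa using h2.symm
  obtain ⟨P, Y, Y', Z, rfl⟩ : ∃ P Y Y' Z, X = fromBlocks P Y Y' Z :=
    ⟨_, _, _, _, (fromBlocks_toBlocks X).symm⟩
  rw [trace_fromBlocks_eq_add] at hX
  obtain ⟨P₁, hP₁, hPZ⟩ := hZ Z
  have h1 : fromBlocks P Y Y' Z = fromBlocks (P - P₁) 0 0 0 + fromBlocks P₁ 0 0 Z +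
      fromBlocks 0 Y 0 0 + fromBlocks 0 0 Y' 0 := by
    simp [fromBlocks_add]
  rw [h1]
  refine U.add_mem (U.add_mem (U.add_mem (hsl _ ?_) hPZ) (hY _)) (hY' _)
  rw [trace_sub]
  linear_combination hX - hP₁

end Blocks

end FibBraid

namespace FibBraid

open Matrix

/-! ### The induction step for irreducibility. -/

section BlockSum

variable {α β : Type} [Fintype α] [DecidableEq α] [Fintype β] [DecidableEq β]
variable {E E' : Matrix α α ℂ} {Q : Matrix α β ℂ} {c d : ℂ}

/-- Column f of Qᴴ is zero, so the scalar vanishes; multiplying by Q on the right then gives Y = 0.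
-/
theorem eq_zero_of_mul_conjTranspose_eq_smul_one (hQ : Qᴴ * Q = 1) {f : α}
    (hf : ∀ b, Q f b = 0) {Y : Matrix α β ℂ} {z : ℂ} (h : Y * Qᴴ = z • 1) : Y = 0 ∧ z = 0 := by
  have hz : z = 0 := by
    have := congrFun (congrFun h f) f
    simpa [Matrix.mul_apply, hf] using this.symm
  refine ⟨?_, hz⟩
  have := congrArg (· * Q) h
  simpa [hz, Matrix.mul_assoc, hQ] using this

/-- Suppose all upper left blocks occurring in U are scalar. After conjugation by the crossing, Y,
Y' and Z - x contribute to that block multiples of E Y Qᴴ, Q Y' Eᴴ and Q(Z - x)Qᴴ. Being scalar, all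
three vanish by the previous lemma, so U would consist of scalars. -/
theorem exists_fromBlocks_mem_of_not_scalar {U : Submodule ℂ (Matrix (α ⊕ β) (α ⊕ β) ℂ)}
    (hgrade : ∀ P Y Y' Z, fromBlocks P Y Y' Z ∈ U →
      fromBlocks 0 Y 0 0 ∈ U ∧ fromBlocks 0 0 Y' 0 ∈ U ∧ fromBlocks P 0 0 Z ∈ U)
    (hE : E * E' = 1) (hQ : Qᴴ * Q = 1) {f : α} (hf : ∀ b, Q f b = 0) (hd : d ≠ 0)
    (hσ : fromBlocks E (d • Q) (d • Qᴴ) (c • 1) ∈ unitaryGroup (α ⊕ β) ℂ)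
    (hU : ∀ X ∈ U, fromBlocks E (d • Q) (d • Qᴴ) (c • 1) * X *
      star (fromBlocks E (d • Q) (d • Qᴴ) (c • 1)) ∈ U)
    (hX : ∃ X ∈ U, ∀ z : ℂ, X ≠ z • 1) :
    ∃ P Z, fromBlocks P 0 0 Z ∈ U ∧ ∀ z : ℂ, P ≠ z • 1 := by
  have hds : star d ≠ 0 := star_ne_zero.mpr hd
  have hE'E : E' * E = 1 := mul_eq_one_comm.mp hE
  by_contra! hcon
  have hcon' : ∀ X ∈ U, ∃ z : ℂ, X.toBlocks₁₁ = z • 1 := by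
    intro X hX
    rw [← fromBlocks_toBlocks X] at hX
    exact hcon _ _ (hgrade _ _ _ _ hX).2.2
  obtain ⟨X, hX, hXs⟩ := hX
  obtain ⟨P, Y, Y', Z, rfl⟩ : ∃ P Y Y' Z, X = fromBlocks P Y Y' Z :=
    ⟨_, _, _, _, (fromBlocks_toBlocks X).symm⟩
  obtain ⟨h1, h2, h3⟩ := hgrade _ _ _ _ hX
  have hY : Y = 0 := by
    obtain ⟨z, hz⟩ := hcon' _ (hU _ h1)
    rw [conj_fromBlocks] at hz
    have hz' : (star d • (E * Y)) * Qᴴ = z • 1 := by simpa [Matrix.smul_mul] using hz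
    have h4 := (eq_zero_of_mul_conjTranspose_eq_smul_one hQ hf hz').1
    have h5 := (smul_eq_zero.mp h4).resolve_left hds
    have h6 := congrArg (E' * ·) h5
    simpa [← Matrix.mul_assoc, hE'E] using h6
  have hY' : Y' = 0 := by
    obtain ⟨z, hz⟩ := hcon' _ (hU _ h2)
    rw [conj_fromBlocks] at hz
    have hz' : d • (Q * Y' * Eᴴ) = z • 1 := by simpa using hz
    have hz'' : (star d • (E * Y'ᴴ)) * Qᴴ = star z • 1 := by
      have := congrArg conjTranspose hz'
      simpa [conjTranspose_smul, conjTranspose_mul, Matrix.mul_assoc] using this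
    have h4 := (eq_zero_of_mul_conjTranspose_eq_smul_one hQ hf hz'').1
    have h5 := (smul_eq_zero.mp h4).resolve_left hds
    have h6 := congrArg (E' * ·) h5
    have h7 : Y'ᴴ = 0 := by simpa [← Matrix.mul_assoc, hE'E] using h6
    exact conjTranspose_eq_zero.mp h7
  obtain ⟨x, hx⟩ := hcon _ _ h3
  subst hY hY' hx
  obtain ⟨z, hz⟩ := hcon' _ (hU _ hX)
  have hsplit : fromBlocks (x • (1 : Matrix α α ℂ)) (0 : Matrix α β ℂ) 0 Z =
      x • 1 + fromBlocks 0 0 0 (Z - x • 1) := by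
    rw [← fromBlocks_one, fromBlocks_smul, fromBlocks_add]
    simp
  have h4 : (d * star d) • (Q * (Z - x • 1) * Qᴴ) = (z - x) • 1 := by
    have h5 := congrArg toBlocks₁₁ (congrArg (fun A => fromBlocks E (d • Q) (d • Qᴴ) (c • 1) * A *
      star (fromBlocks E (d • Q) (d • Qᴴ) (c • 1))) hsplit)
    beta_reduce at h5
    rw [hz, mul_add, add_mul, mul_smul_comm, mul_one, smul_mul_assoc,
      mem_unitaryGroup_iff.mp hσ] at h5
    have h6 : ∀ A B : Matrix (α ⊕ β) (α ⊕ β) ℂ, (A + B).toBlocks₁₁ = A.toBlocks₁₁ + B.toBlocks₁₁ :=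
      fun _ _ => rfl
    rw [h6, conj_fromBlocks, ← fromBlocks_one, fromBlocks_smul, toBlocks_fromBlocks₁₁] at h5
    rw [sub_smul, h5]
    simp
  have h5 : ((d * star d) • (Q * (Z - x • 1))) * Qᴴ = (z - x) • 1 := by
    rw [← h4, Matrix.smul_mul]
  have h6 := (smul_eq_zero.mp (eq_zero_of_mul_conjTranspose_eq_smul_one hQ hf h5).1).resolve_left
    (mul_ne_zero hd hds)
  have h7 : Z - x • 1 = 0 := by
    have := congrArg (Qᴴ * ·) h6
    simpa [← Matrix.mul_assoc, hQ] using this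
  apply hXs x
  rw [hsplit, h7]
  simp

/-- Irreducibility of the action on traceless matrices passes from one block to a larger space. -/
theorem AdIrreducible.sum [Nonempty α] [Nonempty β] {S : Set (Matrix α α ℂ)} (hS : AdIrreducible S)
    {S' : Set (Matrix (α ⊕ β) (α ⊕ β) ℂ)} (hcard : Fintype.card β < Fintype.card α) {l : ℂ}
    (hl : l * star l = 1) (hl2 : l ^ 2 ≠ 1)
    (hD : fromBlocks (l • 1) 0 0 1 ∈ Submonoid.closure S')
    (hlift : ∀ g ∈ S, ∃ h, fromBlocks g 0 0 h ∈ S')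
    (hE : E * E' = 1) (hQ : Qᴴ * Q = 1) {f : α} (hf : ∀ b, Q f b = 0) (hd : d ≠ 0)
    (hσ : fromBlocks E (d • Q) (d • Qᴴ) (c • 1) ∈ unitaryGroup (α ⊕ β) ℂ)
    (hσS : fromBlocks E (d • Q) (d • Qᴴ) (c • 1) ∈ S') : AdIrreducible S' := by
  intro U hU hX
  have hgrade : ∀ P Y Y' Z, fromBlocks P Y Y' Z ∈ U →
      fromBlocks 0 Y 0 0 ∈ U ∧ fromBlocks 0 0 Y' 0 ∈ U ∧ fromBlocks P 0 0 Z ∈ U :=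
    fun P Y Y' Z h => fromBlocks_mem_of_conj_diagonal hl hl2 (conj_mem_of_mem_closure hU hD) h
  have hconj : ∀ g ∈ S, ∃ h, ∀ P Z, fromBlocks P 0 0 Z ∈ U →
      fromBlocks (g * P * star g) 0 0 (h * Z * star h) ∈ U := by
    intro g hg
    obtain ⟨h, hh⟩ := hlift g hg
    refine ⟨h, fun P Z hPZ => ?_⟩
    have := hU _ hh _ hPZ
    rw [star_eq_conjTranspose, fromBlocks_conjTranspose, fromBlocks_multiply,
      fromBlocks_multiply] at this
    simpa [star_eq_conjTranspose] using this
  obtain ⟨P₀, Z₀, hmem, hP₀⟩ :=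
    exists_fromBlocks_mem_of_not_scalar hgrade hE hQ hf hd hσ (hU _ hσS) hX
  let A : Submodule ℂ (Matrix α α ℂ) :=
    { carrier := {P | ∃ Z, fromBlocks P 0 0 Z ∈ U}
      zero_mem' := ⟨0, by rw [fromBlocks_zero]; exact U.zero_mem⟩
      add_mem' := by
        rintro P P' ⟨Z, h⟩ ⟨Z', h'⟩
        exact ⟨Z + Z', by simpa [fromBlocks_add] using U.add_mem h h'⟩
      smul_mem' := by
        rintro x P ⟨Z, h⟩
        exact ⟨x • Z, by simpa [fromBlocks_smul] using U.smul_mem x h⟩ }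
  let K : Submodule ℂ (Matrix α α ℂ) :=
    { carrier := {P | fromBlocks P 0 0 0 ∈ U}
      zero_mem' := by
        show fromBlocks 0 0 0 0 ∈ U
        rw [fromBlocks_zero]; exact U.zero_mem
      add_mem' := fun h h' => by simpa [fromBlocks_add] using U.add_mem h h'
      smul_mem' := fun x P h => by simpa [fromBlocks_smul] using U.smul_mem x h }
  have hA : ∀ P : Matrix α α ℂ, P.trace = 0 → P ∈ A := hS A (by
    rintro g hg P ⟨Z, hZ⟩
    obtain ⟨h, hh⟩ := hconj g hg
    exact ⟨_, hh P Z hZ⟩) ⟨P₀, ⟨Z₀, hmem⟩, hP₀⟩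
  -- Otherwise α² ≤ β² + 2 for the block sizes, impossible when 1 ≤ β < α.
  have hK : ∃ P ∈ K, ∀ z : ℂ, P ≠ z • 1 := by
    by_contra! hcon
    have h1 := card_sq_le_of_forall_exists hcon hA
    have h2 : 0 < Fintype.card β := Fintype.card_pos
    nlinarith
  have hsl : ∀ P : Matrix α α ℂ, P.trace = 0 → P ∈ K := hS K (by
    intro g hg P hP
    obtain ⟨h, hh⟩ := hconj g hg
    have := hh P 0 hP
    rwa [Matrix.mul_zero, Matrix.zero_mul] at this) hK
  exact mem_of_forall_fromBlocks_mem hgrade hE hQ hf hd hσ (hU _ hσS) hsl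

end BlockSum

end FibBraid

namespace FibBraid

open Matrix

/-! ### The case of size two. -/

/-- A diagonal matrix and a matrix mixing the two coordinates act irreducibly on the traceless
matrices of size two. -/
theorem adIrreducible_fin_two {S : Set (Matrix (Fin 2) (Fin 2) ℂ)} {a b c d e : ℂ}
    (ha : a * star a = 1) (hb : b * star b = 1) (hab : (a * star b) ^ 2 ≠ 1)
    (hS : !![a, 0; 0, b] ∈ S) (hσ : !![e, d; d, c] ∈ S) (hd : d ≠ 0) (he : e ≠ 0)
    (horth : e * star d + d * star c = 0) : AdIrreducible S := by
  intro U hU hX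
  have hconj : ∀ {p y y' z : ℂ}, !![p, y; y', z] ∈ U →
      !![p, a * star b * y; star (a * star b) * y', z] ∈ U := by
    intro p y y' z h
    convert hU _ hS _ h using 1
    ext i j
    fin_cases i <;> fin_cases j <;> simp [Matrix.mul_apply, Fin.sum_univ_two] <;>
      simp only [Complex.star_def] at ha hb
    · linear_combination (-p) * ha
    · ring
    · ring
    · linear_combination (-z) * hb
  have hll : (a * star b) * star (a * star b) = 1 := by
    rw [star_mul', star_star]
    linear_combination (a * star a) * hb + ha
  generalize a * star b = l at *
  have hcomb : ∀ {p y y' z p₁ y₁ y₁' z₁ : ℂ} (r s : ℂ), !![p, y; y', z] ∈ U →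
      !![p₁, y₁; y₁', z₁] ∈ U →
      !![r * p + s * p₁, r * y + s * y₁; r * y' + s * y₁', r * z + s * z₁] ∈ U := by
    intro p y y' z p₁ y₁ y₁' z₁ r s h h'
    simpa using U.add_mem (U.smul_mem r h) (U.smul_mem s h')
  have hl1 : l - 1 ≠ 0 := fun h0 => hab (by rw [sub_eq_zero.mp h0, one_pow])
  have hll' : l - star l ≠ 0 := fun h0 => hab (by
    rw [pow_two]; nth_rw 2 [sub_eq_zero.mp h0]; exact hll)
  have hl1' : star l - 1 ≠ 0 := fun h0 => hl1 (by
    have := congrArg star h0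
    simpa using this)
  -- Conjugation by the diagonal matrix has eigenvalues 1, l, l⁻¹, where l⁻¹ is `star l`; the
  -- polynomial (T - 1)(T - l⁻¹) keeps only the upper right entry.
  have h12 : ∀ {p y y' z : ℂ}, !![p, y; y', z] ∈ U → !![0, y; 0, 0] ∈ U := by
    intro p y y' z h
    have h1 := hconj h
    convert U.smul_mem ((l - 1) * (l - star l))⁻¹
      (hcomb 1 (star l) (hcomb 1 (-(1 + star l)) (hconj h1) h1) h) using 1
    ext i j
    fin_cases i <;> fin_cases j <;> simp
    · right; ring
    · simp only [Complex.star_def] at hll' ⊢; field_simp; ring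
    · right; ring
    · right; ring
  have h21 : ∀ {p y y' z : ℂ}, !![p, y; y', z] ∈ U → !![0, 0; y', 0] ∈ U := by
    intro p y y' z h
    have h1 := hconj h
    convert U.smul_mem ((star l - 1) * (star l - l))⁻¹
      (hcomb 1 l (hcomb 1 (-(1 + l)) (hconj h1) h1) h) using 1
    have : star l - l ≠ 0 := fun h => hll' (by rw [← neg_sub, h, neg_zero])
    ext i j
    fin_cases i <;> fin_cases j <;> simp
    · right; ring
    · right; ring
    · simp only [Complex.star_def] at this hl1' ⊢; field_simp; ring
    · right; ring
  have hdiag : ∀ {p y y' z : ℂ}, !![p, y; y', z] ∈ U → !![p, 0; 0, z] ∈ U := by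
    intro p y y' z h
    simpa using hcomb 1 (-1) (hcomb 1 (-1) h (h12 h)) (h21 h)
  have hsc : ∀ {p y y' z : ℂ}, !![p, y; y', z] ∈ U →
      !![e * p * star e + e * y * star d + d * y' * star e + d * z * star d,
        e * p * star d + e * y * star c + d * y' * star d + d * z * star c;
        d * p * star e + d * y * star d + c * y' * star e + c * z * star d,
        d * p * star d + d * y * star c + c * y' * star d + c * z * star c] ∈ U := by
    intro p y y' z h
    convert hU _ hσ _ h using 1
    ext i j
    fin_cases i <;> fin_cases j <;> simp [Matrix.mul_apply, Fin.sum_univ_two] <;> ring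
  have hds : star d ≠ 0 := star_ne_zero.mpr hd
  have hscale12 : ∀ {y : ℂ}, y ≠ 0 → !![0, y; 0, 0] ∈ U → ∀ x, !![0, x; 0, 0] ∈ U := by
    intro y hy h x
    simpa [hy] using U.smul_mem (x / y) h
  have hscale21 : ∀ {y : ℂ}, y ≠ 0 → !![0, 0; y, 0] ∈ U → ∀ x, !![0, 0; x, 0] ∈ U := by
    intro y hy h x
    simpa [hy] using U.smul_mem (x / y) h
  -- A nonzero off-diagonal entry of X can be isolated, and the mixing matrix moves a lower left one
  -- to the upper right. If X is diagonal, mixing produces the upper right entry e·d̄ times the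
  -- difference of its diagonal entries, by `horth`.
  have hE : ∀ x, !![0, x; 0, 0] ∈ U := by
    obtain ⟨X, hX, hXs⟩ := hX
    rw [eta_fin_two X] at hX
    by_cases hy : X 0 1 = 0
    · by_cases hy' : X 1 0 = 0
      · rw [hy, hy'] at hX
        refine hscale12 ?_ (h12 (hsc hX))
        have : X 0 0 - X 1 1 ≠ 0 := fun h0 => hXs (X 0 0) (by
          ext i j
          fin_cases i <;> fin_cases j <;> simp [hy, hy', (sub_eq_zero.mp h0).symm])
        have h1 : e * star d * (X 0 0 - X 1 1) ≠ 0 := mul_ne_zero (mul_ne_zero he hds) this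
        convert h1 using 1
        linear_combination X 1 1 * horth
      · refine hscale12 ?_ (h12 (hsc (h21 hX)))
        simpa using ⟨⟨hd, hy'⟩, hd⟩
    · exact hscale12 hy (h12 hX)
  have hE' : ∀ x, !![0, 0; x, 0] ∈ U := by
    refine hscale21 ?_ (h21 (hsc (hE 1)))
    simpa using hd
  have hZ : ∀ x, !![x, 0; 0, -x] ∈ U := by
    intro x
    have h1 := U.smul_mem (x / (e * star d)) (hdiag (hsc (hE 1)))
    have h2 : d * star c = -(e * star d) := by linear_combination horth
    have h3 : e * star d ≠ 0 := mul_ne_zero he hds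
    convert h1 using 1
    simp only [mul_one, mul_zero, zero_mul, add_zero, zero_add, h2, smul_of, smul_cons,
      smul_eq_mul, smul_empty, mul_neg, div_mul_cancel₀ _ h3]
  intro X hX0
  rw [trace_fin_two] at hX0
  rw [eta_fin_two X, show X 1 1 = -X 0 0 by linear_combination hX0]
  simpa using hcomb 1 1 (hZ (X 0 0)) (hcomb 1 1 (hE (X 0 1)) (hE' (X 1 0)))

end FibBraid

namespace FibBraid

open Matrix

open FibBraid.Symbol

/-! ### Recursion and reversal for strings. -/

section Append

variable {n : ℕ}

/-- Add a symbol at the end of a string. -/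
def append {x y : Symbol} (z : Symbol) (hz : ¬ (y = ast ∧ z = ast)) (s : BlockString n x y) :
    BlockString (n + 1) x z :=
  ⟨⟨Fin.snoc (α := fun _ => Symbol) s.1.1 z, by
      intro i
      induction i using Fin.lastCases with
      | last =>
        rw [Fin.snoc_castSucc, s.2.2, Fin.succ_last, Fin.snoc_last]
        exact hz
      | cast i =>
        rw [Fin.snoc_castSucc, Fin.succ_castSucc, Fin.snoc_castSucc]
        exact s.1.2 i⟩, by
    refine ⟨?_, Fin.snoc_last (α := fun _ => Symbol) _ _⟩
    have : (0 : Fin (n + 1 + 1)) = Fin.castSucc 0 := rfl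
    dsimp only
    rw [this, Fin.snoc_castSucc, s.2.1]⟩

@[simp]
theorem append_castSucc {x y z : Symbol} (hz : ¬ (y = ast ∧ z = ast)) (s : BlockString n x y)
    (j : Fin (n + 1)) : (append z hz s).1.1 j.castSucc = s.1.1 j :=
  Fin.snoc_castSucc (α := fun _ => Symbol) _ _ _

@[simp]
theorem append_last {x y z : Symbol} (hz : ¬ (y = ast ∧ z = ast)) (s : BlockString n x y) :
    (append z hz s).1.1 (Fin.last (n + 1)) = z := Fin.snoc_last (α := fun _ => Symbol) _ _

/-- Remove the last symbol of a string. -/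
def initString (s : SymbolString (n + 1)) : SymbolString n :=
  ⟨fun j => s.1 j.castSucc, fun i => s.2 i.castSucc⟩

theorem blockString_ext {x y : Symbol} {s t : BlockString n x y} (h : ∀ j, s.1.1 j = t.1.1 j) :
    s = t := Subtype.ext (Subtype.ext (funext h))

theorem append_eq_of_init {x y z : Symbol} (hz : ¬ (y = ast ∧ z = ast)) (s : BlockString n x y)
    (t : BlockString (n + 1) x z) (h : ∀ j : Fin (n + 1), t.1.1 j.castSucc = s.1.1 j) :
    append z hz s = t := by
  apply blockString_ext
  intro j
  induction j using Fin.lastCases with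
  | last => rw [append_last, t.2.2]
  | cast j => rw [append_castSucc, h]

/-- The strings ending in `p` are obtained by adding a `p` to an arbitrary string. -/
noncomputable def appendPEquiv (n : ℕ) (x : Symbol) :
    BlockString n x p ⊕ BlockString n x ast ≃ BlockString (n + 1) x p :=
  Equiv.ofBijective (Sum.elim (append p (by simp)) (append p (by simp))) (by
    constructor
    · have hinit : ∀ {y y' : Symbol} (s : BlockString n x y) (s' : BlockString n x y'),
          append p (by simp) s = append p (by simp) s' → ∀ j, s.1.1 j = s'.1.1 j := by
        intro y y' s s' h j
        rw [← append_castSucc (z := p) (by simp) s, h, append_castSucc]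
      rintro (s | s) (t | t) h
      · exact congrArg Sum.inl (blockString_ext (hinit s t h))
      · have := hinit s t h (Fin.last n)
        simp [s.2.2, t.2.2] at this
      · have := hinit s t h (Fin.last n)
        simp [s.2.2, t.2.2] at this
      · exact congrArg Sum.inr (blockString_ext (hinit s t h))
    · intro t
      have h0 : (initString t.1).1 0 = x := t.2.1
      rcases h : (initString t.1).1 (Fin.last n) with _ | _
      · exact ⟨Sum.inr ⟨initString t.1, h0, h⟩, append_eq_of_init (by simp) _ _ fun _ => rfl⟩
      · exact ⟨Sum.inl ⟨initString t.1, h0, h⟩, append_eq_of_init (by simp) _ _ fun _ => rfl⟩)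

@[simp]
theorem appendPEquiv_inl (x : Symbol) (s : BlockString n x p) :
    appendPEquiv n x (Sum.inl s) = append p (by simp) s := rfl

@[simp]
theorem appendPEquiv_inr (x : Symbol) (s : BlockString n x ast) :
    appendPEquiv n x (Sum.inr s) = append p (by simp) s := rfl

/-- The strings ending in `*` are obtained by adding a `*` to a string ending in `p`. -/
noncomputable def appendAstEquiv (n : ℕ) (x : Symbol) :
    BlockString n x p ≃ BlockString (n + 1) x ast :=
  Equiv.ofBijective (append ast (by simp)) (by
    constructor
    · intro s t h
      apply blockString_ext
      intro j
      rw [← append_castSucc (z := ast) (by simp) s, h, append_castSucc]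
    · intro t
      have h0 : (initString t.1).1 0 = x := t.2.1
      have hl : (initString t.1).1 (Fin.last n) = p := by
        have h1 := t.1.2 (Fin.last n)
        rw [Fin.succ_last, t.2.2] at h1
        show t.1.1 (Fin.last n).castSucc = p
        cases h : t.1.1 (Fin.last n).castSucc <;> simp_all
      exact ⟨⟨initString t.1, h0, hl⟩, append_eq_of_init _ _ _ fun _ => rfl⟩)

/-- Both counts enter the same Fibonacci recursion. On one strand there is only `*p`, and `**` is
forbidden. -/
theorem card_blockString_ast (n : ℕ) :
    Fintype.card (BlockString (n + 1) ast p) = Nat.fib (n + 1) ∧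
      Fintype.card (BlockString (n + 1) ast ast) = Nat.fib n := by
  induction n with
  | zero =>
    constructor
    · rw [zero_add, Nat.fib_one, Fintype.card_eq_one_iff]
      refine ⟨⟨⟨![ast, p], by intro i; fin_cases i; simp⟩, rfl, rfl⟩, fun s => ?_⟩
      apply blockString_ext
      intro j
      fin_cases j
      · exact s.2.1
      · exact s.2.2
    · rw [Nat.fib_zero, Fintype.card_eq_zero_iff]
      refine ⟨fun s => s.1.2 0 ⟨s.2.1, s.2.2⟩⟩
  | succ n ih =>
    constructor
    · rw [← Fintype.card_congr (appendPEquiv (n + 1) ast), Fintype.card_sum, ih.1, ih.2, add_comm,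
        ← Nat.fib_add_two]
    · rw [← Fintype.card_congr (appendAstEquiv (n + 1) ast), ih.1]

/-- Reading strings from right to left. -/
def revEquiv (n : ℕ) (x y : Symbol) : BlockString n x y ≃ BlockString n y x where
  toFun s := ⟨⟨fun j => s.1.1 j.rev, fun i h => s.1.2 i.rev
    ⟨by rw [← Fin.rev_succ]; exact h.2, by rw [← Fin.rev_castSucc]; exact h.1⟩⟩,
    by simpa using s.2.2, by simpa using s.2.1⟩
  invFun s := ⟨⟨fun j => s.1.1 j.rev, fun i h => s.1.2 i.rev
    ⟨by rw [← Fin.rev_succ]; exact h.2, by rw [← Fin.rev_castSucc]; exact h.1⟩⟩,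
    by simpa using s.2.2, by simpa using s.2.1⟩
  left_inv s := blockString_ext fun j => by simp
  right_inv s := blockString_ext fun j => by simp

end Append

/-! ### Crossings under appending a symbol and under reversal. -/

section Crossing

/-- The matrices of the elementary crossings on a block. -/
def crossings (n : ℕ) (x y : Symbol) : Set (Matrix (BlockString n x y) (BlockString n x y) ℂ) :=
  Set.range fun i => blockMatrix x y (crossingMatrix i)

theorem exists_blockRep_eq {n : ℕ} {x y : Symbol}
    {g : Matrix (BlockString n x y) (BlockString n x y) ℂ} (hg : g ∈ crossings n x y) :
    ∃ h, (blockRep n x y h : Matrix _ _ ℂ) = g := by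
  obtain ⟨i, rfl⟩ := hg
  refine ⟨PresentedGroup.of i, ?_⟩
  show blockMatrix x y (fibRep n (PresentedGroup.of i)).1 = _
  rw [fibRep, PresentedGroup.toGroup.of]
  rfl

/-- The appended symbol lies beyond the right neighbour of the crossing, so it takes no part in the
local rule. -/
theorem crossingMatrix_append {n : ℕ} (i : Fin (n - 1)) (i' : Fin (n + 1 - 1))
    (hi : i'.val = i.val) {x y y' z : Symbol} (hy : ¬ (y = ast ∧ z = ast))
    (hy' : ¬ (y' = ast ∧ z = ast)) (t : BlockString n x y) (s : BlockString n x y') :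
    crossingMatrix i' (append z hy t).1 (append z hy' s).1 = crossingMatrix i t.1 s.1 := by
  have hL : posL i' = (posL i).castSucc := Fin.ext (by simp [posL, hi])
  have hM : posM i' = (posM i).castSucc := Fin.ext (by simp [posM, hi])
  have hR : posR i' = (posR i).castSucc := Fin.ext (by simp [posR, hi])
  have hlast : Fin.last (n + 1) ≠ (posM i).castSucc := (Fin.castSucc_lt_last _).ne'
  have : (∀ j, j ≠ posM i' → (append z hy t).1.1 j = (append z hy' s).1.1 j) ↔
      ∀ j, j ≠ posM i → t.1.1 j = s.1.1 j := by
    rw [Fin.forall_fin_succ']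
    simp [hM, hlast]
  rw [hM] at this
  simp only [crossingMatrix, localMatrix, this, hL, hM, hR, append_castSucc]

/-- The local rules are symmetric in the two outer symbols. -/
theorem crossingMatrix_rev {n : ℕ} (i : Fin (n - 1)) {x y : Symbol} (t s : BlockString n x y) :
    crossingMatrix i.rev (revEquiv n x y t).1 (revEquiv n x y s).1 = crossingMatrix i t.1 s.1 := by
  have hL : (posL i.rev).rev = posR i := Fin.ext (by simp [posL, posR]; omega)
  have hM : (posM i.rev).rev = posM i := Fin.ext (by simp [posM]; omega)
  have hR : (posR i.rev).rev = posL i := Fin.ext (by simp [posL, posR]; omega)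
  have hval : ∀ (u : BlockString n x y) j, (revEquiv n x y u).1.1 j = u.1.1 j.rev := fun _ _ => rfl
  have : (∀ j, j ≠ posM i.rev → t.1.1 j.rev = s.1.1 j.rev) ↔
      ∀ j, j ≠ posM i → t.1.1 j = s.1.1 j := by
    constructor
    · intro h j hj
      have := h j.rev (fun h' => hj (by rw [← hM, ← h', Fin.rev_rev]))
      simpa using this
    · intro h j hj
      exact h _ (fun h' => hj (by rw [← Fin.rev_rev j, h', ← hM, Fin.rev_rev]))
  simp only [crossingMatrix, localMatrix, hval, this, hL, hM, hR]
  congr 1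
  cases s.1.1 (posL i) <;> cases s.1.1 (posR i) <;> cases s.1.1 (posM i) <;>
    cases t.1.1 (posM i) <;> rfl

end Crossing

end FibBraid

namespace FibBraid

open Matrix

open FibBraid.Symbol

/-! ### Arithmetic of the constants in terms of a and τ. -/

section Constants

theorem tau_sq_add : (tau : ℂ) ^ 2 + tau = 1 := by exact_mod_cast tau_sq

theorem tau_cast_ne_zero : (tau : ℂ) ≠ 0 := Complex.ofReal_ne_zero.mpr tau_pos.ne'

theorem ca_ne_zero : ca ≠ 0 := fun h => by simpa [h] using ca_mul_star

/-- The product of x² + τx + 1 with its conjugate under τ ↦ -1-τ is x⁴ - x³ + x² - x + 1, the tenth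
cyclotomic polynomial. -/
theorem ca_pow_five : ca ^ 5 = -1 := by
  have h1 := ca_sq
  have h2 := tau_sq_add
  grind

theorem ca_sq_ne_one : ca ^ 2 ≠ 1 := by
  intro h
  have h5 := ca_pow_five
  have h1 := ca_sq
  have h2 := tau_sq_add
  have h3 : ca = -1 := by grind
  rw [h3] at h1
  have h4 : (tau : ℂ) = 2 := by linear_combination -h1
  rw [h4] at h2
  norm_num at h2

theorem ca_sq_sq_ne_one : (ca ^ 2) ^ 2 ≠ 1 := by
  intro h
  apply ca_sq_ne_one
  have h5 := ca_pow_five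
  have h3 : ca = -1 := by linear_combination (-ca) * h + h5
  rw [h3]; norm_num

theorem ce_eq_neg_tau : ce = -tau := by
  rw [ce_eq]
  linear_combination (tau : ℂ) * ca_sq

theorem cc_eq_neg : cc = -tau * ca ^ 3 := by
  rw [cc_eq]
  linear_combination (tau : ℂ) * ca * ca_sq

theorem cd_sq : cd ^ 2 = (ca ^ 2 - ca) ^ 2 * (tau : ℂ) ^ 3 := by
  have h3 : ((tau ^ (3 / 2 : ℝ) : ℝ) : ℂ) ^ 2 = (tau : ℂ) ^ 3 := by exact_mod_cast tau_rpow_sq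
  rw [cd_eq, mul_pow, h3]

theorem cd_ne_zero : cd ≠ 0 := by
  intro h
  have h1 := cd_sq
  rw [h] at h1
  have h2 : (ca ^ 2 - ca) ^ 2 * (tau : ℂ) ^ 3 ≠ 0 := by
    refine mul_ne_zero (pow_ne_zero _ ?_) (pow_ne_zero _ tau_cast_ne_zero)
    intro h3
    have h4 : ca * (ca - 1) = 0 := by linear_combination h3
    rcases mul_eq_zero.mp h4 with h5 | h5
    · exact ca_ne_zero h5
    · exact ca_sq_ne_one (by rw [sub_eq_zero.mp h5, one_pow])
  exact h2 (by rw [← h1]; ring)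

theorem ce_ne_zero : ce ≠ 0 := by
  rw [ce_eq_neg_tau]; exact neg_ne_zero.mpr tau_cast_ne_zero

theorem cb_mul_star : cb * star cb = 1 := by
  rw [cb_eq, star_pow, ← mul_pow, ca_mul_star, one_pow]

theorem star_ca : star ca = -ca ^ 4 := by
  linear_combination star ca * ca_pow_five - ca ^ 4 * ca_mul_star

theorem star_cc : star cc = tau * ca ^ 2 := by
  have h : star (tau : ℂ) = tau := Complex.conj_ofReal _
  rw [cc_eq_neg, star_mul', star_neg, h, star_pow, star_ca]
  linear_combination (tau : ℂ) * ca ^ 2 * (ca ^ 5 - 1) * ca_pow_five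

theorem star_cd : star cd = cd * ca ^ 2 := by
  have h : star ((tau ^ (3 / 2 : ℝ) : ℝ) : ℂ) = ((tau ^ (3 / 2 : ℝ) : ℝ) : ℂ) :=
    Complex.conj_ofReal _
  rw [cd_eq, star_mul', h, star_sub, star_pow, star_ca]
  linear_combination ((tau ^ (3 / 2 : ℝ) : ℝ) : ℂ) * ca ^ 3 * ca_pow_five

theorem star_ce : star ce = -tau := by
  rw [ce_eq_neg_tau, star_neg]
  exact congrArg Neg.neg (Complex.conj_ofReal _)

theorem cd_sq_mul : cd ^ 2 * ca ^ 2 = 1 - (tau : ℂ) ^ 2 := by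
  rw [cd_sq]
  have h5 := ca_pow_five
  have h1 := ca_sq
  have h2 := tau_sq_add
  grind

/-- Together with the next two identities: on the strings `p*p`, `ppp` the crossing block σ
satisfies σ diag(a⁴, a²) σ = diag(1, a²). This drives the induction in `twist_apply`. -/
theorem cc_sq_mul_add : cc ^ 2 * ca ^ 4 + cd ^ 2 * ca ^ 2 = 1 := by
  rw [cc_eq_neg]
  linear_combination (tau : ℂ) ^ 2 * (ca ^ 5 - 1) * ca_pow_five + cd_sq_mul

theorem ce_sq_mul_add : ce ^ 2 * ca ^ 2 + cd ^ 2 * ca ^ 4 = ca ^ 2 := by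
  rw [ce_eq_neg_tau, cd_sq]
  have h5 := ca_pow_five
  have h1 := ca_sq
  have h2 := tau_sq_add
  grind

theorem cc_mul_add_ce : cc * ca ^ 2 + ce = 0 := by
  rw [ce_eq_neg_tau, cc_eq_neg]
  linear_combination -(tau : ℂ) * ca_pow_five

end Constants

/-! ### A product of crossings that is diagonal on strings starting with `*`. -/

section Twist

/-- The product of crossings that moves the strand at position `k` around all strands to its
left. -/
noncomputable def twist (n : ℕ) : ℕ → Matrix (SymbolString n) (SymbolString n) ℂ
  | 0 => 1
  | k + 1 => if h : k < n - 1 then crossingMatrix ⟨k, h⟩ * twist n k * crossingMatrix ⟨k, h⟩ else 1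

/-- The eigenvalue of a twist on two consecutive symbols. -/
noncomputable def twistValue : Symbol → Symbol → ℂ
  | ast, _ => 1
  | p, p => ca ^ 2
  | p, ast => ca ^ 4

theorem crossingMatrix_apply {n : ℕ} (i : Fin (n - 1)) (t s : SymbolString n) :
    crossingMatrix i t s =
      dg ca cb cc ce (t.1 (posL i)) (t.1 (posM i)) (t.1 (posR i)) * (if t = s then 1 else 0) +
      od cd (t.1 (posL i)) (t.1 (posR i)) * (if tflip i t = s then 1 else 0) := by
  have := localMatrix_mul_apply ca cb cc cd ce i 1 t s
  rw [mul_one] at this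
  rw [crossingMatrix, this, one_apply, one_apply]

/-- If a twist is diagonal with values depending on the left and middle symbols of the next
crossing, sandwiching it between two copies of that crossing gives a diagonal matrix with values
depending on the middle and right symbols. The induction starts at the identity because the first
symbol is `*`, whose `twistValue` is 1. -/
theorem twist_apply {n : ℕ} (hn : 0 < n) (k : ℕ) (hk : k < n) (t s : SymbolString n)
    (ht : t.1 0 = ast) :
    twist n k t s = (if t = s then 1 else 0) *
      twistValue (t.1 ⟨k, by omega⟩) (t.1 ⟨k + 1, by omega⟩) := by
  induction k generalizing t s with
  | zero =>
    have : t.1 ⟨0, by omega⟩ = ast := ht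
    rw [twist, this, twistValue, one_apply, mul_one]
  | succ k ih =>
    have hk' : k < n - 1 := by omega
    rw [twist, dif_pos hk']
    set i : Fin (n - 1) := ⟨k, hk'⟩ with hi
    have hD : ∀ t s : SymbolString n, t.1 0 = ast → (twist n k * crossingMatrix i) t s =
        twistValue (t.1 (posL i)) (t.1 (posM i)) * crossingMatrix i t s := by
      intro t s ht
      rw [mul_apply, Finset.sum_eq_single t]
      · rw [ih (by omega) _ _ ht, if_pos rfl, one_mul]; rfl
      · intro u _ hu
        rw [ih (by omega) _ _ ht, if_neg hu.symm, zero_mul, zero_mul]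
      · simp
    have hft : (tflip i t).1 0 = ast := by
      rw [tflip_of_ne _ _ _ (by simp [posM, Fin.ext_iff]), ht]
    rw [mul_assoc, crossingMatrix, localMatrix_mul_apply, ← crossingMatrix, hD _ _ ht, hD _ _ hft,
      crossingMatrix_apply, crossingMatrix_apply, tflip_tflip]
    simp only [tflip_of_ne _ _ _ (posL_ne i), tflip_of_ne _ _ _ (posR_ne i)]
    have hM' := tflip_M i t
    have vL := p_of_starL t i
    have vR := p_of_starR t i
    have eM : t.1 ⟨k + 1, by omega⟩ = t.1 (posM i) := rfl
    have eR : t.1 ⟨k + 1 + 1, by omega⟩ = t.1 (posR i) := rfl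
    rw [eM, eR]
    generalize (if t = s then (1 : ℂ) else 0) = x
    generalize (if tflip i t = s then (1 : ℂ) else 0) = y
    revert hM' vL vR
    generalize (tflip i t).1 (posM i) = m'
    have hb := cb_eq
    cases hL : t.1 (posL i) <;> cases hM : t.1 (posM i) <;> cases hR : t.1 (posR i) <;>
      intro hM' vL vR
    all_goals simp [other] at hM' vL vR
    all_goals try subst hM'
    all_goals simp only [dg, od, twistValue, hb, zero_mul, add_zero]
    · ring
    · ring
    · linear_combination x * cc_sq_mul_add + y * cd * ca ^ 2 * cc_mul_add_ce
    · ring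
    · linear_combination x * ce_sq_mul_add + y * cd * ca ^ 2 * cc_mul_add_ce

end Twist

end FibBraid

namespace FibBraid

open Matrix

open FibBraid.Symbol

/-! ### Block form of the crossings on strings ending in `p`. -/

section LastCrossing

/-- `FixesEnds` is carried along because restriction to a block is multiplicative only in its
presence. -/
theorem blockMatrix_twist_mem {n : ℕ} (x y : Symbol) {κ : Type} [Fintype κ] [DecidableEq κ]
    (e : κ ≃ BlockString n x y) (k : ℕ) :
    FixesEnds (twist n k) ∧ (blockMatrix x y (twist n k)).submatrix e e ∈
      Submonoid.closure ((fun M => M.submatrix e e) '' crossings n x y) := by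
  have h1 : FixesEnds (1 : Matrix (SymbolString n) (SymbolString n) ℂ) ∧
      (blockMatrix x y (1 : Matrix (SymbolString n) (SymbolString n) ℂ)).submatrix e e ∈
      Submonoid.closure ((fun M => M.submatrix e e) '' crossings n x y) := by
    constructor
    · intro t s h
      have : t ≠ s := by rintro rfl; exact h ⟨rfl, rfl⟩
      simp [this]
    · rw [blockMatrix_one, submatrix_one_equiv]
      exact one_mem _
  induction k with
  | zero => exact h1
  | succ k ih =>
    rw [twist]
    split_ifs with h
    · have hc := FixesEnds.crossingMatrix (⟨k, h⟩ : Fin (n - 1))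
      refine ⟨(hc.mul ih.1).mul hc, ?_⟩
      rw [blockMatrix_mul _ _ _ _ (hc.mul ih.1), blockMatrix_mul _ _ _ _ hc,
        ← submatrix_mul_equiv _ _ _ e, ← submatrix_mul_equiv _ _ _ e]
      have hm : (blockMatrix x y (crossingMatrix (⟨k, h⟩ : Fin (n - 1)))).submatrix e e ∈
          Submonoid.closure ((fun M => M.submatrix e e) '' crossings n x y) :=
        Submonoid.subset_closure ⟨_, ⟨_, rfl⟩, rfl⟩
      exact mul_mem (mul_mem hm ih.2) hm
    · exact h1

variable {m : ℕ}

/-- Replace the final `*` of a string by `p`. -/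
def raiseLast {x : Symbol} (s : BlockString (m + 1) x ast) : BlockString (m + 1) x p :=
  ⟨⟨Function.update s.1.1 (Fin.last (m + 1)) p, by
    intro i
    rw [Function.update_of_ne (Fin.castSucc_lt_last i).ne]
    by_cases hi : i.succ = Fin.last (m + 1)
    · rw [hi, Function.update_self]; simp
    · rw [Function.update_of_ne hi]; exact s.1.2 i⟩, by
    constructor
    · exact (Function.update_of_ne (Fin.last_pos).ne p s.1.1).trans s.2.1
    · exact Function.update_self _ _ _⟩

theorem eq_raiseLast_iff {x : Symbol} (t : BlockString (m + 1) x p)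
    (s : BlockString (m + 1) x ast) :
    t = raiseLast s ↔ ∀ j : Fin (m + 1), t.1.1 j.castSucc = s.1.1 j.castSucc := by
  constructor
  · rintro rfl j
    exact Function.update_of_ne (Fin.castSucc_lt_last j).ne _ _
  · intro h
    apply blockString_ext
    intro j
    induction j using Fin.lastCases with
    | last => rw [t.2.2, (raiseLast s).2.2]
    | cast j =>
      rw [h]
      exact (Function.update_of_ne (Fin.castSucc_lt_last j).ne _ _).symm

/-- The coefficients of the strings ending in `*` in those ending in `p`, when the last symbol is
changed. -/
def raiseMatrix (m : ℕ) (x : Symbol) :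
    Matrix (BlockString (m + 1) x p) (BlockString (m + 1) x ast) ℂ :=
  fun t s => if t = raiseLast s then 1 else 0

theorem raiseMatrix_conjTranspose_mul (m : ℕ) (x : Symbol) :
    (raiseMatrix m x)ᴴ * raiseMatrix m x = 1 := by
  ext s s'
  rw [Matrix.mul_apply, Finset.sum_eq_single (raiseLast s)]
  · have : raiseLast s = raiseLast s' ↔ s = s' := by
      constructor
      · intro h
        apply blockString_ext
        intro j
        induction j using Fin.lastCases with
        | last => rw [s.2.2, s'.2.2]
        | cast j =>
          rw [← (eq_raiseLast_iff _ s).mp rfl, ← (eq_raiseLast_iff _ s').mp rfl, h]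
      · rintro rfl; rfl
    simp [conjTranspose_apply, raiseMatrix, this, one_apply]
  · intro t _ ht
    simp [conjTranspose_apply, raiseMatrix, ht]
  · simp

/-- The last crossing, on the strings ending in `p`, sorted by the symbol before the last. -/
theorem lastCrossing_submatrix (m : ℕ) (x : Symbol) (i : Fin (m + 1 + 1 - 1)) (hi : i.val = m) :
    (blockMatrix x p (crossingMatrix i)).submatrix (appendPEquiv (m + 1) x)
      (appendPEquiv (m + 1) x) =
    fromBlocks (diagonal fun t => if t.1.1 (Fin.last m).castSucc = ast then ca else ce)
      (cd • raiseMatrix m x) (cd • (raiseMatrix m x)ᴴ) (cc • 1) := by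
  have hL : posL i = (Fin.last m).castSucc.castSucc := Fin.ext (by simp [posL, hi])
  have hM : posM i = (Fin.last (m + 1)).castSucc := Fin.ext (by simp [posM, hi])
  have hR : posR i = Fin.last (m + 2) := Fin.ext (by simp [posR, hi])
  have hagree : ∀ {y y' : Symbol} (t : BlockString (m + 1) x y) (s : BlockString (m + 1) x y'),
      (∀ j, j ≠ (Fin.last (m + 1)).castSucc →
        (append p (by simp) t).1.1 j = (append p (by simp) s).1.1 j) ↔
      ∀ j : Fin (m + 1), t.1.1 j.castSucc = s.1.1 j.castSucc := by
    intro y y' t s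
    have h1 : Fin.last (m + 2) ≠ (Fin.last (m + 1)).castSucc := (Fin.castSucc_lt_last _).ne'
    have h2 : ∀ j : Fin (m + 1), j.castSucc ≠ Fin.last (m + 1) :=
      fun j => (Fin.castSucc_lt_last j).ne
    rw [Fin.forall_fin_succ', Fin.forall_fin_succ']
    simp [h1, h2]
  have hsame : ∀ {y : Symbol} (t s : BlockString (m + 1) x y),
      (∀ j : Fin (m + 1), t.1.1 j.castSucc = s.1.1 j.castSucc) ↔ t = s := by
    intro y t s
    constructor
    · intro h
      apply blockString_ext
      intro j
      induction j using Fin.lastCases with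
      | last => rw [t.2.2, s.2.2]
      | cast j => exact h j
    · rintro rfl _; rfl
  have hbefore : ∀ s : BlockString (m + 1) x ast, s.1.1 (Fin.last m).castSucc = p := by
    intro s
    have h1 := s.1.2 (Fin.last m)
    rw [Fin.succ_last, s.2.2] at h1
    cases h : s.1.1 (Fin.last m).castSucc <;> simp_all
  ext (t | t) (s | s)
  · simp only [submatrix_apply, blockMatrix, crossingMatrix, localMatrix, appendPEquiv_inl,
      fromBlocks_apply₁₁, hagree, hsame, hL, hM, hR, append_castSucc, append_last, t.2.2, s.2.2,
      diagonal_apply]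
    split_ifs with h1 h2
    · rw [← h1, h2]; rfl
    · rw [← h1]
      cases h3 : t.1.1 (Fin.last m).castSucc
      · exact absurd h3 h2
      · rfl
    · rfl
  · simp only [submatrix_apply, blockMatrix, crossingMatrix, localMatrix, appendPEquiv_inl,
      appendPEquiv_inr, fromBlocks_apply₁₂, hagree, ← eq_raiseLast_iff, hL, hM, hR,
      append_castSucc, append_last, t.2.2, s.2.2, hbefore, Matrix.smul_apply, raiseMatrix]
    split_ifs <;> simp [localRule]
  · simp only [submatrix_apply, blockMatrix, crossingMatrix, localMatrix, appendPEquiv_inl,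
      appendPEquiv_inr, fromBlocks_apply₂₁, hagree, hL, hM, hR,
      append_castSucc, append_last, t.2.2, s.2.2, Matrix.smul_apply, conjTranspose_apply,
      raiseMatrix]
    have h1 : (∀ j : Fin (m + 1), t.1.1 j.castSucc = s.1.1 j.castSucc) ↔ s = raiseLast t := by
      rw [eq_raiseLast_iff]; exact forall_congr' fun j => eq_comm
    simp only [h1]
    split_ifs with h2
    · rw [(eq_raiseLast_iff _ _).mp h2, hbefore]
      simp [localRule]
    · simp
  · simp only [submatrix_apply, blockMatrix, crossingMatrix, localMatrix, appendPEquiv_inr,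
      fromBlocks_apply₂₂, hagree, hsame, hL, hM, hR, append_castSucc, append_last, t.2.2, s.2.2,
      hbefore, Matrix.smul_apply, one_apply]
    split_ifs <;> simp [localRule]

/-- The off-diagonal blocks vanish because such a crossing leaves the last symbol of the shorter
string unchanged. -/
theorem earlierCrossing_submatrix {n : ℕ} (x : Symbol) (i : Fin (n - 1)) (i' : Fin (n + 1 - 1))
    (hi : i'.val = i.val) :
    (blockMatrix x p (crossingMatrix i')).submatrix (appendPEquiv n x) (appendPEquiv n x) =
    fromBlocks (blockMatrix x p (crossingMatrix i)) 0 0 (blockMatrix x ast (crossingMatrix i)) := by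
  have hz : ∀ {y y' : Symbol} (t : BlockString n x y) (s : BlockString n x y'), y ≠ y' →
      crossingMatrix i t.1 s.1 = 0 := fun t s h => FixesEnds.crossingMatrix i _ _ (by
    rw [t.2.2, s.2.2]; exact fun h' => h h'.2)
  ext (t | t) (s | s) <;>
    simp [blockMatrix, crossingMatrix_append i i' hi, hz]

/-- The last two symbols are `pp` on the first block and `*p` on the second, with twist values a²
and 1. This is the matrix diag(l, 1) needed in `AdIrreducible.sum`. -/
theorem twist_submatrix (m : ℕ) :
    (blockMatrix ast p (twist (m + 2) (m + 1))).submatrix (appendPEquiv (m + 1) ast)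
      (appendPEquiv (m + 1) ast) = fromBlocks (ca ^ 2 • 1) 0 0 1 := by
  have hL : (⟨m + 1, by omega⟩ : Fin (m + 3)) = (Fin.last (m + 1)).castSucc := rfl
  have hR : (⟨m + 1 + 1, by omega⟩ : Fin (m + 3)) = Fin.last (m + 2) := rfl
  ext t s
  rw [submatrix_apply, blockMatrix, submatrix_apply, twist_apply (by omega) _ (by omega) _ _
    (appendPEquiv (m + 1) ast t).2.1, hL, hR, (appendPEquiv (m + 1) ast t).2.2]
  have : (appendPEquiv (m + 1) ast t).1 = (appendPEquiv (m + 1) ast s).1 ↔ t = s := by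
    rw [Subtype.val_inj, (appendPEquiv (m + 1) ast).apply_eq_iff_eq]
  simp only [this]
  rcases t with t | t <;> rcases s with s | s <;>
    simp [t.2.2, twistValue, one_apply]

end LastCrossing

end FibBraid

namespace FibBraid

open Matrix

open FibBraid.Symbol

/-! ### A quotient of two crossings no power of which is scalar. -/

section InfiniteOrder

theorem irrational_tau : Irrational tau := by
  have h5 : Irrational (Real.sqrt 5) := by
    have := (Nat.prime_five).irrational_sqrt
    exact_mod_cast this
  rw [tau_eq]
  have : (Real.sqrt 5 - 1) / 2 = (Real.sqrt 5 - (1 : ℤ)) / (2 : ℕ) := by push_cast; ring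
  rw [this]
  exact (h5.sub_intCast 1).div_natCast two_ne_zero

theorem eq_zero_of_add_mul_tau_eq_zero {x y : ℤ} (h : (x : ℂ) + y * tau = 0) : x = 0 ∧ y = 0 := by
  have h1 : (x : ℝ) + y * tau = 0 := by exact_mod_cast h
  have hy : y = 0 := by
    by_contra hy
    have hy' : (y : ℝ) ≠ 0 := Int.cast_ne_zero.mpr hy
    apply irrational_tau
    refine ⟨(-x : ℤ) / (y : ℤ), ?_⟩
    push_cast
    field_simp
    linarith
  refine ⟨?_, hy⟩
  rw [hy] at h1
  simpa using h1

/-- The powers of a matrix satisfying `M² v = τ² M v - v` are given on `v` by elements of `ℤ[τ]`,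
whose conjugates grow. -/
theorem exists_pow_mulVec_eq {ι : Type} [Fintype ι] [DecidableEq ι] {M : Matrix ι ι ℂ} {v : ι → ℂ}
    (h : M *ᵥ (M *ᵥ v) = (tau : ℂ) ^ 2 • (M *ᵥ v) - v) (k : ℕ) :
    ∃ x y x' y' : ℤ, (M ^ (k + 1)) *ᵥ v =
        ((x : ℂ) + y * tau) • (M *ᵥ v) - ((x' : ℂ) + y' * tau) • v ∧
      0 ≤ (x' : ℝ) - y' * (1 + tau) ∧
      (x' : ℝ) - y' * (1 + tau) + 1 ≤ (x : ℝ) - y * (1 + tau) := by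
  induction k with
  | zero => exact ⟨1, 0, 0, 0, by simp, by simp, by simp⟩
  | succ k ih =>
    obtain ⟨x, y, x', y', h1, h2, h3⟩ := ih
    -- The new coefficient of M v is τ²(x + yτ) - (x' + y'τ), expanded with τ² = 1 - τ.
    refine ⟨x - y - x', 2 * y - x - y', x, y, ?_, ?_, ?_⟩
    · rw [pow_succ', ← mulVec_mulVec, h1, mulVec_sub, mulVec_smul, mulVec_smul, h]
      ext i
      simp only [Pi.sub_apply, Pi.smul_apply, smul_eq_mul]
      push_cast
      have ht := tau_sq_add
      linear_combination (x + y * (tau : ℂ) - y) * (M *ᵥ v) i * ht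
    · linarith
    · push_cast
      have ht := tau_sq
      have hp := tau_pos
      have h4 : 0 ≤ tau * ((x : ℝ) - y * (1 + tau)) := mul_nonneg hp.le (by linarith)
      -- The conjugate of τ is -(1+τ), with square 2 + τ. The conjugate coefficients therefore
      -- follow X ↦ (2+τ)X - X', and the gap X - X' ≥ 1 persists.
      have h5 : (x - y - x' : ℝ) - (2 * y - x - y') * (1 + tau) = 
        (2 + tau) * (x - y * (1 + tau)) - (x' - y' * (1 + tau)) := by
        linear_combination (y : ℝ) * ht
      rw [h5]
      nlinarith

/-- On the plane of v and w the matrix g h⁻¹ has trace τ(a⁴ - a) = τ² and determinant 1, which gives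
the recursion of `exists_pow_mulVec_eq` by Cayley–Hamilton. -/
theorem hasInfiniteOrder_of_mulVec {ι : Type} [Fintype ι] [DecidableEq ι]
    {S : Set (Matrix ι ι ℂ)} {g h : Matrix ι ι ℂ} (hg : g ∈ S) (hh : h ∈ S)
    (hu : h ∈ unitaryGroup ι ℂ) {v w : ι} (hvw : v ≠ w)
    (gv : g *ᵥ Pi.single v 1 = ca • Pi.single v 1) (gw : g *ᵥ Pi.single w 1 = cb • Pi.single w 1)
    (hv : h *ᵥ Pi.single v 1 = ce • Pi.single v 1 + cd • Pi.single w 1)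
    (hw : h *ᵥ Pi.single w 1 = cd • Pi.single v 1 + cc • Pi.single w 1) : HasInfiniteOrder S := by
  have h5 := ca_pow_five
  have hd := cd_sq_mul
  have hstar : ∀ x : ι → ℂ, star h *ᵥ (h *ᵥ x) = x := by
    intro x
    rw [mulVec_mulVec, mem_unitaryGroup_iff'.mp hu, one_mulVec]
  have hsv : star h *ᵥ Pi.single v 1 = star ce • Pi.single v 1 + star cd • Pi.single w 1 := by
    rw [← hstar (star ce • Pi.single v 1 + star cd • Pi.single w 1), mulVec_add, mulVec_smul,
      mulVec_smul, hv, hw]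
    congr 1
    have e1 : star ce * ce + star cd * cd = 1 := by
      rw [star_ce, star_cd, ce_eq_neg_tau]
      linear_combination hd
    have e2 : star ce * cd + star cd * cc = 0 := by
      rw [star_ce, star_cd, cc_eq_neg]
      linear_combination (-(tau : ℂ) * cd) * h5
    rw [smul_add, smul_add, smul_smul, smul_smul, smul_smul, smul_smul, add_add_add_comm,
      ← add_smul, ← add_smul, e1, e2, one_smul, zero_smul, add_zero]
  have hsw : star h *ᵥ Pi.single w 1 = star cd • Pi.single v 1 + star cc • Pi.single w 1 := by
    rw [← hstar (star cd • Pi.single v 1 + star cc • Pi.single w 1), mulVec_add, mulVec_smul,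
      mulVec_smul, hv, hw]
    congr 1
    have e1 : star cd * ce + star cc * cd = 0 := by
      rw [star_cd, star_cc, ce_eq_neg_tau]
      ring
    have e2 : star cd * cd + star cc * cc = 1 := by
      rw [star_cd, star_cc, cc_eq_neg]
      linear_combination hd - (tau : ℂ) ^ 2 * h5
    rw [smul_add, smul_add, smul_smul, smul_smul, smul_smul, smul_smul, add_add_add_comm,
      ← add_smul, ← add_smul, e1, e2, one_smul, zero_smul, zero_add]
  have hMv : (g * star h) *ᵥ Pi.single v 1 =
      (star ce * ca) • Pi.single v 1 + (star cd * cb) • Pi.single w 1 := by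
    rw [← mulVec_mulVec, hsv, mulVec_add, mulVec_smul, mulVec_smul, gv, gw, smul_smul, smul_smul]
  have hMw : (g * star h) *ᵥ Pi.single w 1 =
      (star cd * ca) • Pi.single v 1 + (star cc * cb) • Pi.single w 1 := by
    rw [← mulVec_mulVec, hsw, mulVec_add, mulVec_smul, mulVec_smul, gv, gw, smul_smul, smul_smul]
  have hrec : (g * star h) *ᵥ ((g * star h) *ᵥ Pi.single v 1) =
      (tau : ℂ) ^ 2 • ((g * star h) *ᵥ Pi.single v 1) - Pi.single v 1 := by
    rw [hMv, mulVec_add, mulVec_smul, mulVec_smul, hMv, hMw]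
    have e1 : (star ce * ca) * (star ce * ca) + (star cd * cb) * (star cd * ca) =
        (tau : ℂ) ^ 2 * (star ce * ca) - 1 := by
      rw [star_ce, star_cd, cb_eq]
      linear_combination (tau : ℂ) ^ 2 * ca_sq + cd ^ 2 * ca ^ 2 * h5 - hd
    have e2 : (star ce * ca) * (star cd * cb) + (star cd * cb) * (star cc * cb) =
        (tau : ℂ) ^ 2 * (star cd * cb) := by
      rw [star_ce, star_cd, star_cc, cb_eq]
      linear_combination cd * tau * ca ^ 3 * (h5 - ca_sq)
    ext i
    simp only [Pi.add_apply, Pi.sub_apply, Pi.smul_apply, smul_eq_mul]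
    linear_combination (Pi.single v (1 : ℂ) : ι → ℂ) i * e1 + (Pi.single w (1 : ℂ) : ι → ℂ) i * e2
  refine ⟨g, hg, h, hh, fun k hk z hz => ?_⟩
  obtain ⟨k, rfl⟩ := Nat.exists_eq_succ_of_ne_zero hk.ne'
  obtain ⟨x, y, x', y', hk1, hk2, hk3⟩ := exists_pow_mulVec_eq hrec k
  rw [hz, hMv] at hk1
  have hw1 := congrFun hk1 w
  simp only [smul_mulVec, one_mulVec, Pi.add_apply, Pi.sub_apply, Pi.smul_apply, smul_eq_mul,
    Pi.single_eq_same, Pi.single_eq_of_ne hvw.symm, mul_zero, mul_one, zero_add, sub_zero] at hw1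
  have hne : star cd * cb ≠ 0 := mul_ne_zero (star_ne_zero.mpr cd_ne_zero) (by
    rw [cb_eq]; exact pow_ne_zero _ ca_ne_zero)
  -- A scalar power has no w-component on v, so x + yτ = 0. Irrationality of τ gives x = y = 0,
  -- whereas the conjugate x - y(1+τ) is at least 1.
  obtain ⟨rfl, rfl⟩ := eq_zero_of_add_mul_tau_eq_zero
    ((mul_eq_zero.mp hw1.symm).resolve_right hne)
  simp only [Int.cast_zero] at hk3
  linarith

end InfiniteOrder

end FibBraid

namespace FibBraid

open Matrix

open FibBraid.Symbol

/-! ### Irreducibility and infinite order for the crossings, and the conclusion. -/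

section Main

theorem ite_ast_p {P : Prop} [Decidable P] : (if P then ast else p) = ast ↔ P := by
  split_ifs with h <;> simp [h]

/-- The string `*pp…p`. -/
def startString (n : ℕ) (hn : 3 ≤ n) : BlockString n ast p :=
  ⟨⟨fun j => if j.val = 0 then ast else p, fun i => by simp⟩, by
    refine ⟨by simp, ?_⟩
    exact if_neg (by simp only [Fin.val_last]; omega)⟩

/-- The string `*p*p…p`. -/
def secondString (n : ℕ) (hn : 3 ≤ n) : BlockString n ast p :=
  ⟨⟨fun j => if j.val = 0 ∨ j.val = 2 then ast else p, fun i => by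
      rw [ite_ast_p, ite_ast_p, Fin.val_castSucc, Fin.val_succ]
      omega⟩, by
    refine ⟨by simp, ?_⟩
    exact if_neg (by simp only [Fin.val_last]; omega)⟩

variable {n : ℕ} (hn : 3 ≤ n)

theorem startString_ne_secondString : startString n hn ≠ secondString n hn := by
  intro h
  have := congrArg (fun s => s.1.1 ⟨2, by omega⟩) h
  simp [startString, secondString] at this

theorem tflip_startString : tflip ⟨1, by omega⟩ (startString n hn).1 = (secondString n hn).1 := by
  apply Subtype.ext
  funext j
  by_cases hj : j = posM (⟨1, by omega⟩ : Fin (n - 1))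
  · rw [hj, tflip_M]
    · simp [startString, secondString, posM, other]
    · simp [startString, posL]
    · simp [startString, posR]
  · rw [tflip_of_ne _ _ _ hj]
    have : j.val ≠ 2 := fun h => hj (Fin.ext (by simp [posM, h]))
    simp [startString, secondString, this]

/-- The first symbol is `*`, so the symbol under the first crossing cannot change and the crossing
is diagonal. -/
theorem firstCrossing_mulVec (s : BlockString n ast p) :
    blockMatrix ast p (crossingMatrix (⟨0, by omega⟩ : Fin (n - 1))) *ᵥ Pi.single s 1 =
      dg ca cb cc ce ast (s.1.1 ⟨1, by omega⟩) (s.1.1 ⟨2, by omega⟩) • Pi.single s (1 : ℂ) := by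
  ext t
  have hL : t.1.1 (posL (⟨0, by omega⟩ : Fin (n - 1))) = ast := t.2.1
  rw [mulVec_single_one, col_apply, blockMatrix, submatrix_apply, crossingMatrix_apply, hL, od,
    zero_mul, add_zero, Pi.smul_apply, Pi.single_apply, smul_eq_mul]
  simp only [Subtype.val_inj]
  by_cases h : t = s
  · subst h; rfl
  · simp [h]
  · simp

theorem secondCrossing_mulVec (s s' : BlockString n ast p)
    (h : tflip ⟨1, by omega⟩ s.1 = s'.1) (hs : s.1.1 ⟨1, by omega⟩ = p)
    (hs' : s.1.1 ⟨3, by omega⟩ = p) :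
    blockMatrix ast p (crossingMatrix (⟨1, by omega⟩ : Fin (n - 1))) *ᵥ Pi.single s 1 =
      dg ca cb cc ce p (s.1.1 ⟨2, by omega⟩) p • Pi.single s (1 : ℂ) +
        cd • Pi.single s' (1 : ℂ) := by
  ext t
  have h2 : tflip ⟨1, by omega⟩ t.1 = s.1 ↔ t = s' := by
    rw [← Subtype.val_inj (a := t) (b := s'), ← h]
    constructor
    · intro h'; rw [← h', tflip_tflip]
    · intro h'; rw [h', tflip_tflip]
  rw [mulVec_single_one, col_apply, blockMatrix, submatrix_apply, crossingMatrix_apply,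
    Pi.add_apply, Pi.smul_apply, Pi.smul_apply, Pi.single_apply, Pi.single_apply, smul_eq_mul, smul_eq_mul]
  simp only [Subtype.val_inj, h2]
  congr 1
  · by_cases h' : t = s
    · subst h'
      have e1 : t.1.1 (posL (⟨1, by omega⟩ : Fin (n - 1))) = p := hs
      have e2 : t.1.1 (posR (⟨1, by omega⟩ : Fin (n - 1))) = p := hs'
      rw [e1, e2]; rfl
    · simp [h']
  · by_cases h' : t = s'
    · subst h'
      have e1 : t.1.1 (posL (⟨1, by omega⟩ : Fin (n - 1))) = p := by
        rw [← h, tflip_of_ne _ _ _ (posL_ne _)]; exact hs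
      have e2 : t.1.1 (posR (⟨1, by omega⟩ : Fin (n - 1))) = p := by
        rw [← h, tflip_of_ne _ _ _ (posR_ne _)]; exact hs'
      rw [e1, e2]; rfl
    · simp [h']

theorem firstCrossing_startString :
    blockMatrix ast p (crossingMatrix (⟨0, by omega⟩ : Fin (n - 1))) *ᵥ
      Pi.single (startString n hn) 1 = ca • Pi.single (startString n hn) 1 :=
  firstCrossing_mulVec hn _

theorem firstCrossing_secondString :
    blockMatrix ast p (crossingMatrix (⟨0, by omega⟩ : Fin (n - 1))) *ᵥ
      Pi.single (secondString n hn) 1 = cb • Pi.single (secondString n hn) 1 :=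
  firstCrossing_mulVec hn _

theorem secondCrossing_startString :
    blockMatrix ast p (crossingMatrix (⟨1, by omega⟩ : Fin (n - 1))) *ᵥ
      Pi.single (startString n hn) 1 =
    ce • Pi.single (startString n hn) 1 + cd • Pi.single (secondString n hn) 1 :=
  secondCrossing_mulVec hn _ _ (tflip_startString hn) rfl rfl

theorem secondCrossing_secondString :
    blockMatrix ast p (crossingMatrix (⟨1, by omega⟩ : Fin (n - 1))) *ᵥ
      Pi.single (secondString n hn) 1 =
    cd • Pi.single (startString n hn) 1 + cc • Pi.single (secondString n hn) 1 := by
  exact (secondCrossing_mulVec hn _ _ (by rw [← tflip_startString hn, tflip_tflip]) rfl rfl).trans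
    (add_comm _ _)

theorem mem_unitaryGroup_of_mem_crossings {n : ℕ} {x y : Symbol}
    {g : Matrix (BlockString n x y) (BlockString n x y) ℂ} (hg : g ∈ crossings n x y) :
    g ∈ unitaryGroup (BlockString n x y) ℂ := by
  obtain ⟨h, rfl⟩ := exists_blockRep_eq hg
  exact (blockRep n x y h).2

theorem hasInfiniteOrder_crossings (hn : 3 ≤ n) : HasInfiniteOrder (crossings n ast p) :=
  hasInfiniteOrder_of_mulVec ⟨_, rfl⟩ ⟨_, rfl⟩ (mem_unitaryGroup_of_mem_crossings ⟨_, rfl⟩)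
    (startString_ne_secondString hn) (firstCrossing_startString hn) (firstCrossing_secondString hn)
    (secondCrossing_startString hn) (secondCrossing_secondString hn)

/-- The induction must start here: at three strands the two blocks have equal sizes f₂ = f₁ = 1, and
the dimension count of `AdIrreducible.sum` is not available. -/
theorem adIrreducible_crossings_three : AdIrreducible (crossings 3 ast p) := by
  have hn : 3 ≤ 3 := le_rfl
  let f : Fin 2 → BlockString 3 ast p := ![startString 3 hn, secondString 3 hn]
  have hf : Function.Injective f := by
    have := startString_ne_secondString hn
    intro i j h
    fin_cases i <;> fin_cases j <;> simp_all [f, this.symm]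
  have hbij : Function.Bijective f := (Fintype.bijective_iff_injective_and_card f).mpr
    ⟨hf, by rw [(card_blockString_ast 2).1]; rfl⟩
  let e : Fin 2 ≃ BlockString 3 ast p := Equiv.ofBijective f hbij
  have hentry : ∀ (M : Matrix (BlockString 3 ast p) (BlockString 3 ast p) ℂ) i j,
      M i j = (M *ᵥ Pi.single j 1) i := fun M i j => by rw [mulVec_single_one, col_apply]
  have hne := startString_ne_secondString hn
  refine (adIrreducible_fin_two (S := (fun M => M.submatrix e e) '' crossings 3 ast p) (a := ca)
    (b := cb) (c := cc) (d := cd) (e := ce) ca_mul_star cb_mul_star ?_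
    ⟨_, ⟨⟨0, by omega⟩, rfl⟩, ?_⟩ ⟨_, ⟨⟨1, by omega⟩, rfl⟩, ?_⟩ cd_ne_zero ce_ne_zero ?_).submatrix
    e.symm ?_
  · intro h
    -- Since b = a², the ratio of the two diagonal entries is a⁻¹, so the condition becomes a² ≠ 1.
    have h1 : ca * star cb = star ca := by
      rw [cb_eq, star_pow]
      linear_combination star ca * ca_mul_star
    rw [h1] at h
    have h2 := congrArg star h
    rw [star_pow, star_star, star_one] at h2
    exact ca_sq_ne_one h2
  · ext i j
    refine (hentry (blockMatrix ast p (crossingMatrix (⟨0, by omega⟩ : Fin (3 - 1)))) (e i)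
      (e j)).trans ?_
    fin_cases j
    · refine (congrFun (firstCrossing_startString hn) (e i)).trans ?_
      fin_cases i <;> simp [e, f, hne.symm]
    · refine (congrFun (firstCrossing_secondString hn) (e i)).trans ?_
      fin_cases i <;> simp [e, f, hne]
  · ext i j
    refine (hentry (blockMatrix ast p (crossingMatrix (⟨1, by omega⟩ : Fin (3 - 1)))) (e i)
      (e j)).trans ?_
    fin_cases j
    · refine (congrFun (secondCrossing_startString hn) (e i)).trans ?_
      fin_cases i <;> simp [e, f, hne, hne.symm]
    · refine (congrFun (secondCrossing_secondString hn) (e i)).trans ?_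
      fin_cases i <;> simp [e, f, hne, hne.symm]
  · rw [star_cd, star_cc, ce_eq_neg_tau]; ring
  · rintro _ ⟨g, hg, rfl⟩
    simpa using hg

/-- The block sizes are f_{m+1} and f_m, strictly ordered because m ≥ 2. -/
theorem adIrreducible_crossings_succ (m : ℕ) (hm : 2 ≤ m)
    (ih : AdIrreducible (crossings (m + 1) ast p)) : AdIrreducible (crossings (m + 2) ast p) := by
  let e := appendPEquiv (m + 1) ast
  let S' := (fun M => M.submatrix e e) '' crossings (m + 2) ast p
  obtain ⟨c1, c2⟩ := card_blockString_ast m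
  have : Nonempty (BlockString (m + 1) ast p) :=
    Fintype.card_pos_iff.mp (by rw [c1]; exact Nat.fib_pos.mpr (by omega))
  have : Nonempty (BlockString (m + 1) ast ast) :=
    Fintype.card_pos_iff.mp (by rw [c2]; exact Nat.fib_pos.mpr (by omega))
  -- The string has a `*` just before its final `p`, whereas every raised string ends in `pp`; so
  -- row f of `raiseMatrix` is zero. The two `*` at positions 0 and m are not adjacent since m ≥ 2.
  let f : BlockString (m + 1) ast p :=
    ⟨⟨fun j => if j.val = 0 ∨ j.val = m then ast else p, fun i => by
        rw [ite_ast_p, ite_ast_p, Fin.val_castSucc, Fin.val_succ]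
        omega⟩, by
      refine ⟨by simp, ?_⟩
      exact if_neg (by simp only [Fin.val_last]; omega)⟩
  have hf : ∀ s, raiseMatrix m ast f s = 0 := by
    intro s
    rw [raiseMatrix, if_neg]
    intro h
    have h1 := (eq_raiseLast_iff f s).mp h (Fin.last m)
    have h2 : f.1.1 (Fin.last m).castSucc = ast := if_pos (Or.inr rfl)
    have h3 := s.1.2 (Fin.last m)
    rw [Fin.succ_last] at h3
    exact h3 ⟨h1 ▸ h2, s.2.2⟩
  have hlast := lastCrossing_submatrix m ast ⟨m, by omega⟩ rfl
  have hmem : fromBlocks (diagonal fun t => if t.1.1 (Fin.last m).castSucc = ast then ca else ce)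
      (cd • raiseMatrix m ast) (cd • (raiseMatrix m ast)ᴴ) (cc • 1) ∈ S' :=
    ⟨_, ⟨⟨m, by omega⟩, rfl⟩, hlast⟩
  have hunit : ∀ g ∈ S', g ∈ unitaryGroup _ ℂ := by
    rintro _ ⟨g, hg, rfl⟩
    have := mem_unitaryGroup_iff.mp (mem_unitaryGroup_of_mem_crossings hg)
    rw [mem_unitaryGroup_iff]
    show g.submatrix e e * (star g).submatrix e e = 1
    rw [submatrix_mul_equiv, this, submatrix_one_equiv]
  have hl : ca ^ 2 * star (ca ^ 2) = 1 := by rw [← cb_eq]; exact cb_mul_star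
  have hD := (blockMatrix_twist_mem ast p e (m + 1)).2
  rw [twist_submatrix] at hD
  refine (AdIrreducible.sum ih (S' := S') (by
    rw [c1, c2]; exact Nat.fib_lt_fib_succ hm) hl ca_sq_sq_ne_one hD ?_
    (E' := diagonal fun t => if t.1.1 (Fin.last m).castSucc = ast then ca⁻¹ else ce⁻¹) ?_
    (raiseMatrix_conjTranspose_mul m ast) hf cd_ne_zero (hunit _ hmem) hmem).submatrix e.symm ?_
  · rintro _ ⟨i, rfl⟩
    have hi : i.val < m + 2 - 1 := by omega
    exact ⟨_, _, ⟨⟨i.val, hi⟩, rfl⟩, earlierCrossing_submatrix ast i ⟨i.val, hi⟩ rfl⟩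
  · rw [diagonal_mul_diagonal, ← diagonal_one]
    congr 1
    funext t
    split_ifs
    · exact mul_inv_cancel₀ ca_ne_zero
    · exact mul_inv_cancel₀ ce_ne_zero
  · rintro _ ⟨g, hg, rfl⟩
    simpa using hg

theorem adIrreducible_crossings (hn : 3 ≤ n) : AdIrreducible (crossings n ast p) := by
  induction n, hn using Nat.le_induction with
  | base => exact adIrreducible_crossings_three
  | succ n hn ih =>
    obtain ⟨m, rfl⟩ : ∃ m, n = m + 1 := ⟨n - 1, by omega⟩
    exact adIrreducible_crossings_succ m (by omega) ih

/-- Density passes to a block on which the crossings include those of the block `*p`. -/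
theorem denseModuloPhase_of_equiv {n m : ℕ} (hm : 1 ≤ m) {x y : Symbol}
    (e : BlockString n x y ≃ BlockString m ast p)
    (h : ∀ i : Fin (m - 1), ∃ i' : Fin (n - 1),
      (blockMatrix ast p (crossingMatrix i)).submatrix e e = blockMatrix x y (crossingMatrix i')) :
    DenseModuloPhase (blockRep n x y) := by
  have hcard : Fintype.card (BlockString n x y) = Nat.fib m := by
    obtain ⟨k, rfl⟩ : ∃ k, m = k + 1 := ⟨m - 1, by omega⟩
    rw [Fintype.card_congr e, (card_blockString_ast k).1]
  by_cases hm3 : 3 ≤ m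
  · have : Nonempty (BlockString n x y) :=
      Fintype.card_pos_iff.mp (by rw [hcard]; exact Nat.fib_pos.mpr (by omega))
    have hsub : ∀ g ∈ crossings m ast p, g.submatrix e e ∈ crossings n x y := by
      rintro _ ⟨i, rfl⟩
      obtain ⟨i', hi'⟩ := h i
      exact ⟨i', hi'.symm⟩
    exact denseModuloPhase_of_adIrreducible _ (fun g hg => exists_blockRep_eq hg)
      ((adIrreducible_crossings hm3).submatrix e hsub)
      ((hasInfiniteOrder_crossings hm3).submatrix e hsub)
  -- For m ≤ 2 there is at most one string and the special unitary group is trivial.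
  · refine denseModuloPhase_of_card_le_one _ ?_
    rw [hcard]
    interval_cases m <;> simp

end Main

end FibBraid

open FibBraid in
theorem mainTheorem5 :
    (∀ n : ℕ, 3 ≤ n →
      Fintype.card (FibBraid.BlockString n .ast .ast) = Nat.fib (n - 1) ∧
      FibBraid.DenseModuloPhase (FibBraid.blockRep n .ast .ast)) ∧
    (∀ n : ℕ, 1 ≤ n →
      Fintype.card (FibBraid.BlockString n .ast .p) = Nat.fib n ∧
      FibBraid.DenseModuloPhase (FibBraid.blockRep n .ast .p) ∧
      Fintype.card (FibBraid.BlockString n .p .ast) = Nat.fib n ∧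
      FibBraid.DenseModuloPhase (FibBraid.blockRep n .p .ast)) := by
  constructor
  · intro n hn
    obtain ⟨m, rfl⟩ : ∃ m, n = m + 1 := ⟨n - 1, by omega⟩
    -- Deleting the final `*` leaves the block `*p` on one strand fewer, whose crossings already
    -- generate a dense subgroup; the last crossing is not needed.
    refine ⟨(card_blockString_ast m).2,
      denseModuloPhase_of_equiv (by omega) (appendAstEquiv m .ast).symm fun i =>
        ⟨⟨i.val, by omega⟩, ?_⟩⟩
    ext t s
    obtain ⟨t, rfl⟩ := (appendAstEquiv m .ast).surjective t
    obtain ⟨s, rfl⟩ := (appendAstEquiv m .ast).surjective s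
    rw [Matrix.submatrix_apply, Equiv.symm_apply_apply, Equiv.symm_apply_apply]
    exact (crossingMatrix_append i ⟨i.val, by omega⟩ rfl (by simp) (by simp) t s).symm
  · intro n hn
    have hcard : Fintype.card (BlockString n .ast .p) = Nat.fib n := by
      obtain ⟨m, rfl⟩ : ∃ m, n = m + 1 := ⟨n - 1, by omega⟩
      exact (card_blockString_ast m).1
    refine ⟨hcard, denseModuloPhase_of_equiv hn (Equiv.refl _) fun i => ⟨i, rfl⟩,
      by rw [Fintype.card_congr (revEquiv n .p .ast), hcard],
      denseModuloPhase_of_equiv hn (revEquiv n .p .ast) fun i => ⟨i.rev, ?_⟩⟩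
    ext t s
    have := crossingMatrix_rev i.rev t s
    rwa [Fin.rev_rev] at this
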